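/- Let $1<p<\infty$ and $p'=p/(p-1)$. For $1<r,s<\infty$ put $\pi_{r,s}=2\int_0^1(1-t^s)^{-1/r}\,dt$, and let $\sin_{r,s}:\mathbb R\to[-1,1]$ be the odd, $2\pi_{r,s}$-periodic function that is even with respect to $\pi_{r,s}/2$ and whose restriction to $[0,\pi_{r,s}/2]$ is the inverse of $y\mapsto\int_0^y(1-t^s)^{-1/r}\,dt$, $0\le y\le 1$. Let $\mathcal I=[0,\pi_{2,p'}]$, let $$W^{2,p}_{\mathrm D}(\mathcal I)=\{f\in W^{2,p}(\mathcal I): f(0)=f(\pi_{2,p'})=0\},\qquad \|f\|_{W^{2,p}_{\mathrm D}}=\|f''\|_{L^p(\mathcal I)},$$ be the real Sobolev space with this norm (boundary values are those of the continuous representative), and let $E_2:W^{2,p}_{\mathrm D}(\mathcal I)\to L^{p'}(\mathcal I)$, $E_2f=f$, be the embedding. Then $E_2$ is bounded and $$\|E_2\|=\sup_{0\ne f\in W^{2,p}_{\mathrm D}(\mathcal I)}\frac{\|f\|_{L^{p'}(\mathcal I)}}{\|f''\|_{L^p(\mathcal I)}}=\left(\frac{2}{p'}\right)^{2/p'}\mathrm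 B\!\left(\frac12,\frac{p'+1}{p'}\right)^{\frac1{p'}-\frac1p},$$ where $\mathrm B$ is the Beta function. Moreover, the extremal functions, that is the nonzero $f\in W^{2,p}_{\mathrm D}(\mathcal I)$ with $\|f\|_{L^{p'}(\mathcal I)}/\|f''\|_{L^p(\mathcal I)}=\|E_2\|$, are exactly the functions $f(x)=c\,\sin_{2,p'}(x)$ on $\mathcal I$ with $c\in\mathbb R\setminus\{0\}$. -/

import Mathlib

open MeasureTheory
open scoped ENNReal ContDiff

/-! ## Generalised trigonometric functions -/

/-- `F_{r,s}(y) = ∫₀^y (1 - t^s)^{-1/r} dt` for `y ∈ [0,1]`. -/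
noncomputable def genArcsin (r s y : ℝ) : ℝ :=
  ∫ t in (0 : ℝ)..y, 1 / (1 - t ^ s) ^ (1 / r)

/-- `π_{r,s} = 2 ∫₀¹ (1 - t^s)^{-1/r} dt`. -/
noncomputable def genPi (r s : ℝ) : ℝ :=
  2 * ∫ t in (0 : ℝ)..1, 1 / (1 - t ^ s) ^ (1 / r)

/-- The generalised sine `sin_{r,s} : ℝ → ℝ` with parameters `1 < r, s < ∞`. On `[0, π_{r,s}/2]`
it is the inverse of `F_{r,s} : [0,1] → [0, π_{r,s}/2]`; it is even with respect to `π_{r,s}/2`,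
odd, and `2π_{r,s}`-periodic. Here `y ∈ [-π_{r,s}, π_{r,s})` is `x` reduced modulo `2π_{r,s}`, and
`min |y| (π_{r,s} - |y|) ∈ [0, π_{r,s}/2]` is `|y|` or its reflection in `π_{r,s}/2`. -/
noncomputable def genSin (r s x : ℝ) : ℝ :=
  let y : ℝ := x - 2 * genPi r s * (round (x / (2 * genPi r s)) : ℝ)
  (SignType.sign y : ℝ) *
    Function.invFunOn (genArcsin r s) (Set.Icc 0 1) (min |y| (genPi r s - |y|))

/-! ## Weak derivatives on `(0,T)` -/

/-- Lebesgue measure on the interval `[0,T]`. -/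
noncomputable abbrev intervalMeasure (T : ℝ) : Measure ℝ := volume.restrict (Set.Icc 0 T)

/-- `φ` is a test function on `(0,T)`, that is `φ ∈ C_0^∞((0,T))`. -/
structure IsTestFun (T : ℝ) (φ : ℝ → ℝ) : Prop where
  contDiff : ContDiff ℝ ∞ φ
  hasCompactSupport : HasCompactSupport φ
  tsupport_subset : tsupport φ ⊆ Set.Ioo 0 T

/-- `g` is the weak (distributional) derivative of `f` on `(0,T)`. It is used below only for
`f` and `g` in some `L^p` of the interval. -/
def IsWeakDeriv (T : ℝ) (f g : ℝ → ℝ) : Prop :=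
  ∀ φ : ℝ → ℝ, IsTestFun T φ →
    ∫ x in Set.Icc 0 T, f x * deriv φ x = - ∫ x in Set.Icc 0 T, g x * φ x

/-- `f` has a representative that is continuous on `[0,T]` and vanishes at `0` and at `T`. -/
def VanishesAtEnds (T : ℝ) (f : ℝ → ℝ) : Prop :=
  ∃ g : ℝ → ℝ, f =ᵐ[intervalMeasure T] g ∧ ContinuousOn g (Set.Icc 0 T) ∧ g 0 = 0 ∧ g T = 0

section WeakDerivFacts

lemma IsTestFun.deriv_continuous {T : ℝ} {φ : ℝ → ℝ} (h : IsTestFun T φ) :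
    Continuous (deriv φ) :=
  h.contDiff.continuous_deriv (by simp)

lemma IsTestFun.integrable_mul {T : ℝ} {φ f : ℝ → ℝ} (h : IsTestFun T φ)
    (hf : Integrable f (intervalMeasure T)) :
    Integrable (fun x => f x * φ x) (intervalMeasure T) := by
  obtain ⟨C, hC⟩ := h.hasCompactSupport.exists_bound_of_continuous h.contDiff.continuous
  exact hf.mul_bdd (c := C) h.contDiff.continuous.aestronglyMeasurable
    (Filter.Eventually.of_forall hC)

lemma IsTestFun.integrable_mul_deriv {T : ℝ} {φ f : ℝ → ℝ} (h : IsTestFun T φ)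
    (hf : Integrable f (intervalMeasure T)) :
    Integrable (fun x => f x * deriv φ x) (intervalMeasure T) := by
  obtain ⟨C, hC⟩ := h.hasCompactSupport.deriv.exists_bound_of_continuous h.deriv_continuous
  exact hf.mul_bdd (c := C) h.deriv_continuous.aestronglyMeasurable
    (Filter.Eventually.of_forall hC)

lemma IsTestFun.eq_zero {T x : ℝ} {φ : ℝ → ℝ} (h : IsTestFun T φ) (hx : x ∉ Set.Ioo 0 T) :
    φ x = 0 :=
  image_eq_zero_of_notMem_tsupport fun h' => hx (h.tsupport_subset h')

lemma IsTestFun.setIntegral_eq {T : ℝ} {φ : ℝ → ℝ} (h : IsTestFun T φ) (f : ℝ → ℝ) :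
    ∫ x in Set.Icc 0 T, f x * φ x = ∫ x, f x * φ x := by
  apply setIntegral_eq_integral_of_forall_compl_eq_zero
  intro x hx
  rw [h.eq_zero fun h' => hx (Set.Ioo_subset_Icc_self h'), mul_zero]

/-- The fundamental lemma of the calculus of variations on `(0,T)`. -/
lemma ae_eq_zero_of_forall_testFun {T : ℝ} {f : ℝ → ℝ} (hf : Integrable f (intervalMeasure T))
    (h : ∀ φ, IsTestFun T φ → ∫ x in Set.Icc 0 T, f x * φ x = 0) :
    f =ᵐ[intervalMeasure T] 0 := by
  have h1 : ∀ᵐ x ∂volume, x ∈ Set.Ioo 0 T → f x = 0 := by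
    apply isOpen_Ioo.ae_eq_zero_of_integral_contDiff_smul_eq_zero
    · exact (IntegrableOn.mono_set hf Set.Ioo_subset_Icc_self).locallyIntegrableOn
    · intro g g1 g2 g3
      have := h g ⟨g1, g2, g3⟩
      rw [IsTestFun.setIntegral_eq ⟨g1, g2, g3⟩] at this
      simpa [mul_comm] using this
  have h2 : f =ᵐ[volume.restrict (Set.Ioo 0 T)] 0 :=
    (ae_restrict_iff' measurableSet_Ioo).2 h1
  rwa [restrict_Ioo_eq_restrict_Icc] at h2

lemma IsWeakDeriv.ae_unique {T : ℝ} {f f' g g' : ℝ → ℝ} (h : IsWeakDeriv T f g)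
    (h' : IsWeakDeriv T f' g') (hff : f =ᵐ[intervalMeasure T] f')
    (hg : Integrable g (intervalMeasure T)) (hg' : Integrable g' (intervalMeasure T)) :
    g =ᵐ[intervalMeasure T] g' := by
  have key : (fun x => g x - g' x) =ᵐ[intervalMeasure T] 0 := by
    apply ae_eq_zero_of_forall_testFun (hg.sub hg')
    intro φ hφ
    have e1 := h φ hφ
    have e2 := h' φ hφ
    have e3 : ∫ x in Set.Icc 0 T, f x * deriv φ x = ∫ x in Set.Icc 0 T, f' x * deriv φ x := by
      apply integral_congr_ae
      filter_upwards [hff] with x hx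
      rw [hx]
    have e4 : ∫ x in Set.Icc 0 T, (g x - g' x) * φ x =
        (∫ x in Set.Icc 0 T, g x * φ x) - ∫ x in Set.Icc 0 T, g' x * φ x := by
      rw [← integral_sub (hφ.integrable_mul hg) (hφ.integrable_mul hg')]
      exact integral_congr_ae (Filter.Eventually.of_forall fun x => sub_mul _ _ _)
    exact e4.trans (by linarith)
  filter_upwards [key] with x hx
  simpa [sub_eq_zero] using hx

lemma IsWeakDeriv.congr {T : ℝ} {f f' g g' : ℝ → ℝ} (h : IsWeakDeriv T f g)
    (hf : f =ᵐ[intervalMeasure T] f') (hg : g =ᵐ[intervalMeasure T] g') :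
    IsWeakDeriv T f' g' := by
  intro φ hφ
  have e3 : ∫ x in Set.Icc 0 T, f x * deriv φ x = ∫ x in Set.Icc 0 T, f' x * deriv φ x := by
    apply integral_congr_ae
    filter_upwards [hf] with x hx
    rw [hx]
  have e4 : ∫ x in Set.Icc 0 T, g x * φ x = ∫ x in Set.Icc 0 T, g' x * φ x := by
    apply integral_congr_ae
    filter_upwards [hg] with x hx
    rw [hx]
  rw [← e3, ← e4, h φ hφ]

lemma IsWeakDeriv.add {T : ℝ} {f f' g g' : ℝ → ℝ} (h : IsWeakDeriv T f g)
    (h' : IsWeakDeriv T f' g') (hf : Integrable f (intervalMeasure T))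
    (hf' : Integrable f' (intervalMeasure T)) (hg : Integrable g (intervalMeasure T))
    (hg' : Integrable g' (intervalMeasure T)) : IsWeakDeriv T (f + f') (g + g') := by
  intro φ hφ
  simp only [Pi.add_apply, add_mul]
  rw [integral_add (hφ.integrable_mul_deriv hf) (hφ.integrable_mul_deriv hf'),
    integral_add (hφ.integrable_mul hg) (hφ.integrable_mul hg'), h φ hφ, h' φ hφ]
  ring

lemma IsWeakDeriv.smul {T : ℝ} {f g : ℝ → ℝ} (c : ℝ) (h : IsWeakDeriv T f g) :
    IsWeakDeriv T (c • f) (c • g) := by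
  intro φ hφ
  simp only [Pi.smul_apply, smul_eq_mul, mul_assoc]
  rw [integral_const_mul, integral_const_mul, h φ hφ]
  ring

lemma isWeakDeriv_zero (T : ℝ) : IsWeakDeriv T 0 0 := by
  intro φ _
  simp

lemma VanishesAtEnds.add {T : ℝ} {f g : ℝ → ℝ} (hf : VanishesAtEnds T f)
    (hg : VanishesAtEnds T g) : VanishesAtEnds T (f + g) := by
  obtain ⟨a, a1, a2, a3, a4⟩ := hf
  obtain ⟨b, b1, b2, b3, b4⟩ := hg
  exact ⟨a + b, a1.add b1, a2.add b2, by simp [a3, b3], by simp [a4, b4]⟩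

lemma VanishesAtEnds.smul {T : ℝ} {f : ℝ → ℝ} (c : ℝ) (hf : VanishesAtEnds T f) :
    VanishesAtEnds T (c • f) := by
  obtain ⟨a, a1, a2, a3, a4⟩ := hf
  exact ⟨c • a, a1.const_smul c, a2.const_smul c, by simp [a3], by simp [a4]⟩

lemma VanishesAtEnds.congr {T : ℝ} {f g : ℝ → ℝ} (hf : VanishesAtEnds T f)
    (hfg : f =ᵐ[intervalMeasure T] g) : VanishesAtEnds T g := by
  obtain ⟨a, a1, a2⟩ := hf
  exact ⟨a, hfg.symm.trans a1, a2⟩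

/-- A test function with zero mean is the derivative of a test function. -/
lemma IsTestFun.exists_primitive {T : ℝ} {φ : ℝ → ℝ} (h : IsTestFun T φ)
    (h0 : ∫ x, φ x = 0) : ∃ Φ, IsTestFun T Φ ∧ deriv Φ = φ := by
  have hc := h.contDiff.continuous
  have hi : Integrable φ := hc.integrable_of_hasCompactSupport h.hasCompactSupport
  obtain hK | hK := (tsupport φ).eq_empty_or_nonempty
  · have hz : φ = 0 := tsupport_eq_empty_iff.1 hK
    exact ⟨0, ⟨contDiff_const, HasCompactSupport.zero, by simp [tsupport]⟩, by simp [hz]⟩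
  have hKc : IsCompact (tsupport φ) := h.hasCompactSupport
  obtain ⟨a, ha, hal⟩ := hKc.exists_isLeast hK
  obtain ⟨b, hb, hbl⟩ := hKc.exists_isGreatest hK
  have ha' := h.tsupport_subset ha
  have hb' := h.tsupport_subset hb
  have hout : ∀ x, x ∉ Set.Icc a b → φ x = 0 := fun x hx =>
    image_eq_zero_of_notMem_tsupport fun h' => hx ⟨hal h', hbl h'⟩
  have hder : ∀ x, HasDerivAt (fun x => ∫ t in a..x, φ t) (φ x) x := fun x =>
    intervalIntegral.integral_hasDerivAt_right (hc.intervalIntegrable _ _)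
      (hc.stronglyMeasurableAtFilter _ _) hc.continuousAt
  have hd : deriv (fun x => ∫ t in a..x, φ t) = φ := funext fun x => (hder x).deriv
  have hsup : Function.support (fun x => ∫ t in a..x, φ t) ⊆ Set.Icc a b := by
    intro x hx
    by_contra hxn
    apply hx
    obtain hxa | hxb : x < a ∨ b < x := by
      by_contra! hcon
      exact hxn ⟨hcon.1, hcon.2⟩
    · have : Set.EqOn φ (fun _ => 0) (Set.uIoc a x) := by
        intro t ht
        rw [Set.uIoc_of_ge hxa.le] at ht
        obtain hta | hta := ht.2.lt_or_eq
        · exact hout t fun h' => absurd h'.1 (not_le.2 hta)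
        · by_contra hne
          have hnh : ∀ᶠ y in nhds t, φ y ≠ 0 := hc.continuousAt.eventually_ne hne
          obtain ⟨y, hy1, hy2⟩ := (hnh.filter_mono nhdsWithin_le_nhds |>.and
            (self_mem_nhdsWithin (s := Set.Iio t))).exists
          exact hy1 (hout y fun h' => absurd h'.1 (not_le.2 (hta ▸ hy2)))
      show ∫ t in a..x, φ t = 0
      rw [intervalIntegral.integral_zero_ae (Filter.Eventually.of_forall fun t ht => this ht)]
    · show ∫ t in a..x, φ t = 0
      have hab : a ≤ x := (hal hb).trans hxb.le
      rw [intervalIntegral.integral_of_le hab, ← integral_Icc_eq_integral_Ioc,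
        setIntegral_eq_integral_of_forall_compl_eq_zero, h0]
      intro t ht
      exact hout t fun h' => ht ⟨h'.1, h'.2.trans hxb.le⟩
  have hts : tsupport (fun x => ∫ t in a..x, φ t) ⊆ Set.Icc a b :=
    closure_minimal hsup isClosed_Icc
  refine ⟨fun x => ∫ t in a..x, φ t, ⟨?_, ?_, ?_⟩, hd⟩
  · rw [contDiff_infty_iff_deriv]
    exact ⟨fun x => (hder x).differentiableAt, by rw [hd]; exact h.contDiff⟩
  · exact HasCompactSupport.of_support_subset_isCompact isCompact_Icc hsup
  · exact hts.trans (Set.Icc_subset_Ioo ha'.1 hb'.2)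

/-- A function whose weak derivative vanishes is constant. -/
lemma IsWeakDeriv.exists_const {T : ℝ} (hT : 0 < T) {f g : ℝ → ℝ} (h : IsWeakDeriv T f g)
    (hg : g =ᵐ[intervalMeasure T] 0) (hf : Integrable f (intervalMeasure T)) :
    ∃ c : ℝ, f =ᵐ[intervalMeasure T] fun _ => c := by
  let B : ContDiffBump (T / 2) := ⟨T / 8, T / 4, by positivity, by linarith⟩
  have hψ : IsTestFun T (B.normed volume) := by
    refine ⟨B.contDiff_normed, B.hasCompactSupport_normed, ?_⟩
    rw [B.tsupport_normed_eq, Real.closedBall_eq_Icc]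
    exact Set.Icc_subset_Ioo (by change 0 < T / 2 - T / 4; linarith)
      (by change T / 2 + T / 4 < T; linarith)
  have hψ1 : ∫ x, B.normed volume x = 1 := B.integral_normed
  set ψ : ℝ → ℝ := B.normed volume
  refine ⟨∫ x in Set.Icc 0 T, f x * ψ x, ?_⟩
  set c : ℝ := ∫ x in Set.Icc 0 T, f x * ψ x with hc
  have hci : Integrable (fun _ : ℝ => c) (intervalMeasure T) := integrable_const c
  have key : (fun x => f x - c) =ᵐ[intervalMeasure T] 0 := by
    apply ae_eq_zero_of_forall_testFun (hf.sub hci)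
    intro φ hφ
    set m : ℝ := ∫ x, φ x with hm
    have hφi : Integrable φ :=
      hφ.contDiff.continuous.integrable_of_hasCompactSupport hφ.hasCompactSupport
    have hψi : Integrable ψ :=
      hψ.contDiff.continuous.integrable_of_hasCompactSupport hψ.hasCompactSupport
    have ht : IsTestFun T (fun x => φ x - m * ψ x) := by
      refine ⟨hφ.contDiff.sub (contDiff_const.mul hψ.contDiff),
        hφ.hasCompactSupport.sub (hψ.hasCompactSupport.mul_left (f := fun _ => m)), ?_⟩
      refine (tsupport_sub (f := φ) (g := fun x => m * ψ x)).trans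
        (Set.union_subset hφ.tsupport_subset ?_)
      exact (tsupport_mul_subset_right (f := fun _ => m) (g := ψ)).trans hψ.tsupport_subset
    have h0 : ∫ x, (φ x - m * ψ x) = 0 := by
      rw [integral_sub hφi (hψi.const_mul m), integral_const_mul, hψ1, ← hm]
      ring
    obtain ⟨Φ, hΦ, hΦd⟩ := ht.exists_primitive h0
    have e := h Φ hΦ
    have e0 : ∫ x in Set.Icc 0 T, g x * Φ x = 0 := by
      apply integral_eq_zero_of_ae
      filter_upwards [hg] with x hx
      simp [hx]
    rw [e0, hΦd] at e
    have e1 : ∫ x in Set.Icc 0 T, f x * (φ x - m * ψ x)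
        = (∫ x in Set.Icc 0 T, f x * φ x) - m * c := by
      rw [hc, ← integral_const_mul, ← integral_sub (hφ.integrable_mul hf)
        ((hψ.integrable_mul hf).const_mul m)]
      apply integral_congr_ae
      filter_upwards with x
      ring
    have e2 : ∫ x in Set.Icc 0 T, c * φ x = c * m := by
      rw [hφ.setIntegral_eq (fun _ => c), integral_const_mul]
    have e3 : ∫ x in Set.Icc 0 T, (f x - c) * φ x =
        (∫ x in Set.Icc 0 T, f x * φ x) - ∫ x in Set.Icc 0 T, c * φ x := by
      rw [← integral_sub (hφ.integrable_mul hf) (hφ.integrable_mul hci)]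
      exact integral_congr_ae (Filter.Eventually.of_forall fun x => sub_mul _ _ _)
    exact e3.trans (by linarith)
  filter_upwards [key] with x hx
  simpa [sub_eq_zero] using hx

/-- `x ↦ c x` has weak derivative `c`. -/
lemma isWeakDeriv_linear (T c : ℝ) : IsWeakDeriv T (fun x => c * x) (fun _ => c) := by
  intro φ hφ
  obtain hT | hT := lt_or_ge T 0
  · simp [Set.Icc_eq_empty_of_lt hT]
  have hd : ∀ x, HasDerivAt φ (deriv φ x) x := fun x =>
    (hφ.contDiff.differentiable (by simp) x).hasDerivAt
  have hp := intervalIntegral.integral_mul_deriv_eq_deriv_mul (a := 0) (b := T)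
    (u := fun x => c * x) (u' := fun _ => c) (v := φ) (v' := deriv φ)
    (fun x _ => by simpa using (hasDerivAt_id x).const_mul c) (fun x _ => hd x)
    (by simp) (hφ.deriv_continuous.intervalIntegrable _ _)
  rw [hφ.eq_zero (x := T) (by simp), hφ.eq_zero (x := 0) (by simp)] at hp
  rw [integral_Icc_eq_integral_Ioc, integral_Icc_eq_integral_Ioc,
    ← intervalIntegral.integral_of_le hT, ← intervalIntegral.integral_of_le hT, hp]
  ring

/-- A function with zero boundary values and zero second weak derivative vanishes. -/
lemma ae_eq_zero_of_weakDeriv_two_eq_zero {T : ℝ} {u v w : ℝ → ℝ} (huv : IsWeakDeriv T u v)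
    (hvw : IsWeakDeriv T v w) (hw : w =ᵐ[intervalMeasure T] 0) (hu0 : VanishesAtEnds T u)
    (hu : Integrable u (intervalMeasure T)) (hv : Integrable v (intervalMeasure T)) :
    u =ᵐ[intervalMeasure T] 0 := by
  obtain hT | hT := le_or_gt T 0
  · have : intervalMeasure T = 0 := by
      rw [Measure.restrict_eq_zero, Real.volume_Icc]
      simpa using hT
    rw [this]
    simp [Filter.EventuallyEq]
  obtain ⟨c, hc⟩ := hvw.exists_const hT hw hv
  have hlin : Integrable (fun x : ℝ => -c * x) (intervalMeasure T) :=
    (continuous_const.mul continuous_id).continuousOn.integrableOn_Icc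
  have hadd := huv.add (isWeakDeriv_linear T (-c)) hu hlin hv (integrable_const _)
  obtain ⟨d, hd⟩ := hadd.exists_const hT
    (by filter_upwards [hc] with x hx; simp [hx]) (hu.add hlin)
  obtain ⟨g, hg, hgc, hg0, hgT⟩ := hu0
  have heq : Set.EqOn g (fun x => c * x + d) (Set.Icc 0 T) := by
    apply Measure.eqOn_Icc_of_ae_eq volume hT.ne _ hgc (by fun_prop)
    filter_upwards [hg, hd] with x h1 h2
    rw [← h1]
    simp only [Pi.add_apply] at h2
    linarith
  have e0 := heq (Set.left_mem_Icc.2 hT.le)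
  have e1 := heq (Set.right_mem_Icc.2 hT.le)
  simp only [hg0, hgT] at e0 e1
  have hd0 : d = 0 := by linarith
  have hc0 : c = 0 := by
    have : c * T = 0 := by linarith
    exact (mul_eq_zero.1 this).resolve_right hT.ne'
  filter_upwards [hd] with x h2
  simpa [hd0, hc0] using h2

end WeakDerivFacts

/-! ## The Sobolev space `W^{2,p}_D` and the embedding `E_2` -/

instance fact_one_le_ofReal (p : ℝ) [h : Fact (1 < p)] : Fact (1 ≤ ENNReal.ofReal p) :=
  ⟨by simpa using h.out.le⟩

/-- The Lebesgue space `L^p([0,T])`. -/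
abbrev LpInt (p T : ℝ) : Type := Lp ℝ (ENNReal.ofReal p) (intervalMeasure T)

lemma LpInt.integrable {p T : ℝ} [Fact (1 < p)] (u : LpInt p T) :
    Integrable u (intervalMeasure T) :=
  (Lp.memLp u).integrable (Fact.out : 1 ≤ ENNReal.ofReal p)

/-- `W^{2,p}_D([0,T])` as a subspace of `L^p([0,T])`: the functions in `L^p` whose first and second
weak derivatives are in `L^p`, and whose continuous representative vanishes at `0` and `T`. -/
def sobolevDSubmodule (p T : ℝ) [Fact (1 < p)] : Submodule ℝ (LpInt p T) where
  carrier := {u | (∃ v w : LpInt p T, IsWeakDeriv T u v ∧ IsWeakDeriv T v w) ∧ VanishesAtEnds T u}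
  zero_mem' := by
    have h0 : (0 : ℝ → ℝ) =ᵐ[intervalMeasure T] (0 : LpInt p T) := (Lp.coeFn_zero _ _ _).symm
    exact ⟨⟨0, 0, (isWeakDeriv_zero T).congr h0 h0, (isWeakDeriv_zero T).congr h0 h0⟩,
      ⟨0, h0.symm, continuousOn_const, rfl, rfl⟩⟩
  add_mem' := by
    rintro a b ⟨⟨v, w, h1, h2⟩, h3⟩ ⟨⟨v', w', h1', h2'⟩, h3'⟩
    refine ⟨⟨v + v', w + w', ?_, ?_⟩, (h3.add h3').congr (Lp.coeFn_add a b).symm⟩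
    · exact (h1.add h1' a.integrable b.integrable v.integrable v'.integrable).congr
        (Lp.coeFn_add a b).symm (Lp.coeFn_add v v').symm
    · exact (h2.add h2' v.integrable v'.integrable w.integrable w'.integrable).congr
        (Lp.coeFn_add v v').symm (Lp.coeFn_add w w').symm
  smul_mem' := by
    rintro c a ⟨⟨v, w, h1, h2⟩, h3⟩
    exact ⟨⟨c • v, c • w, (h1.smul c).congr (Lp.coeFn_smul c a).symm (Lp.coeFn_smul c v).symm,
      (h2.smul c).congr (Lp.coeFn_smul c v).symm (Lp.coeFn_smul c w).symm⟩,
      (h3.smul c).congr (Lp.coeFn_smul c a).symm⟩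

/-- The space `W^{2,p}_D([0,T])`. It is a separate type because its norm `‖u''‖_p` differs from the
one it would inherit from `L^p`. -/
def SobolevD (p T : ℝ) [Fact (1 < p)] : Type := sobolevDSubmodule p T

namespace SobolevD

variable {p T : ℝ} [Fact (1 < p)]

noncomputable instance : AddCommGroup (SobolevD p T) :=
  inferInstanceAs (AddCommGroup (sobolevDSubmodule p T))

noncomputable instance : Module ℝ (SobolevD p T) :=
  inferInstanceAs (Module ℝ (sobolevDSubmodule p T))

/-- The inclusion `W^{2,p}_D → L^p`. -/
noncomputable def toLp : SobolevD p T →ₗ[ℝ] LpInt p T := (sobolevDSubmodule p T).subtype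

lemma toLp_injective : Function.Injective (toLp : SobolevD p T → LpInt p T) :=
  Subtype.val_injective

lemma exists_weakDerivs (u : SobolevD p T) :
    ∃ v w : LpInt p T, IsWeakDeriv T (toLp u) v ∧ IsWeakDeriv T v w := u.2.1

lemma vanishesAtEnds (u : SobolevD p T) : VanishesAtEnds T (toLp u) := u.2.2

lemma weakDerivs_unique {u v w v' w' : LpInt p T} (h1 : IsWeakDeriv T u v)
    (h2 : IsWeakDeriv T v w) (h1' : IsWeakDeriv T u v') (h2' : IsWeakDeriv T v' w') : w = w' :=
  Lp.ext (h2.ae_unique h2'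
    (h1.ae_unique h1' Filter.EventuallyEq.rfl v.integrable v'.integrable)
    w.integrable w'.integrable)

/-- The second weak derivative `u'' ∈ L^p` of `u ∈ W^{2,p}_D`. -/
noncomputable def secondDeriv : SobolevD p T →ₗ[ℝ] LpInt p T where
  toFun u := (exists_weakDerivs u).choose_spec.choose
  map_add' a b := by
    have ha := (exists_weakDerivs a).choose_spec.choose_spec
    have hb := (exists_weakDerivs b).choose_spec.choose_spec
    have hab := (exists_weakDerivs (a + b)).choose_spec.choose_spec
    refine weakDerivs_unique hab.1 hab.2 (v' := (exists_weakDerivs a).choose +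
      (exists_weakDerivs b).choose) ?_ ?_
    · rw [map_add]
      exact (ha.1.add hb.1 (LpInt.integrable _) (LpInt.integrable _) (LpInt.integrable _)
        (LpInt.integrable _)).congr (Lp.coeFn_add _ _).symm (Lp.coeFn_add _ _).symm
    · exact (ha.2.add hb.2 (LpInt.integrable _) (LpInt.integrable _) (LpInt.integrable _)
        (LpInt.integrable _)).congr (Lp.coeFn_add _ _).symm (Lp.coeFn_add _ _).symm
  map_smul' c a := by
    have ha := (exists_weakDerivs a).choose_spec.choose_spec
    have hca := (exists_weakDerivs (c • a)).choose_spec.choose_spec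
    refine weakDerivs_unique hca.1 hca.2 (v' := c • (exists_weakDerivs a).choose) ?_ ?_
    · rw [map_smul]
      exact (ha.1.smul c).congr (Lp.coeFn_smul _ _).symm (Lp.coeFn_smul _ _).symm
    · exact (ha.2.smul c).congr (Lp.coeFn_smul _ _).symm (Lp.coeFn_smul _ _).symm

lemma secondDeriv_spec (u : SobolevD p T) :
    ∃ v : LpInt p T, IsWeakDeriv T (toLp u) v ∧ IsWeakDeriv T v (secondDeriv u) :=
  ⟨_, (exists_weakDerivs u).choose_spec.choose_spec⟩

lemma secondDeriv_injective :
    Function.Injective (secondDeriv : SobolevD p T → LpInt p T) := by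
  rw [injective_iff_map_eq_zero]
  intro u hu
  obtain ⟨v, h1, h2⟩ := secondDeriv_spec u
  rw [hu] at h2
  apply toLp_injective
  rw [map_zero, Lp.eq_zero_iff_ae_eq_zero]
  exact ae_eq_zero_of_weakDeriv_two_eq_zero h1 h2 (Lp.coeFn_zero _ _ _) (vanishesAtEnds u)
    (LpInt.integrable _) (LpInt.integrable _)

/-- The norm of `W^{2,p}_D` is `‖u‖ = ‖u''‖_p`. -/
noncomputable instance : NormedAddCommGroup (SobolevD p T) :=
  NormedAddCommGroup.induced _ _ (secondDeriv : SobolevD p T →ₗ[ℝ] LpInt p T) secondDeriv_injective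

noncomputable instance : NormedSpace ℝ (SobolevD p T) :=
  NormedSpace.induced ℝ (SobolevD p T) (LpInt p T) secondDeriv

lemma norm_def (u : SobolevD p T) : ‖u‖ = ‖secondDeriv u‖ := rfl

lemma memLp (q : ℝ) (u : SobolevD p T) :
    MemLp (toLp u) (ENNReal.ofReal q) (intervalMeasure T) := by
  obtain ⟨g, h1, h2, -⟩ := vanishesAtEnds u
  obtain ⟨C, hC⟩ := isCompact_Icc.exists_bound_of_continuousOn h2
  refine (memLp_congr_ae h1).2 (MemLp.of_bound (h2.aestronglyMeasurable measurableSet_Icc) C ?_)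
  exact (ae_restrict_iff' measurableSet_Icc).2 (Filter.Eventually.of_forall hC)

/-- The second order embedding `E_2 : W^{2,p}_D([0,T]) → L^q([0,T])`, `u ↦ u`. -/
noncomputable def embedding (p q T : ℝ) [Fact (1 < p)] [Fact (1 < q)] :
    SobolevD p T →ₗ[ℝ] LpInt q T where
  toFun u := (memLp q u).toLp (toLp u)
  map_add' a b := by
    rw [← MemLp.toLp_add]
    apply MemLp.toLp_congr
    rw [map_add]
    exact Lp.coeFn_add _ _
  map_smul' c a := by
    simp only [RingHom.id_apply]
    rw [← MemLp.toLp_const_smul]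
    apply MemLp.toLp_congr
    rw [map_smul]
    exact Lp.coeFn_smul _ _

end SobolevD

/-! ## Regularity of functions with weak derivatives -/

section Regularity

/-! Write `q = p'` and `T = π_{2,q}`. The second order problem reduces to a sharp first order one.
For `u` in the Sobolev space, integration by parts and Hölder give `∫ u'² = -∫ u u'' ≤ ‖u‖_q
‖u''‖_p`. If `‖u‖_q² ≤ K ‖u'‖_2²` is sharp with extremals `c sin_{2,q}`, then `‖u‖_q ≤ K ‖u''‖_p`,
and equality here forces equality in the first order inequality. Conversely `sin'' = -(q/2)
sin^{q-1}` on the interval, so `|sin''|^p` is a multiple of `sin^q`, Hölder is an equality, and the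
sine attains `K`. This is `SobolevD.norm_embedding_le` and `SobolevD.exists_extremal`.

The first order inequality (`first_order_normalized`, `first_order`) comes from a calibration. Scale
`f` so that `|f| ≤ 1` and `f x₀ = 1`. The sine solves `s' = ±√(1 - s^q)`, so one expands the squares
of `f' ∓ k√(1 - |f|^q)` to the left and right of `x₀`. The cross terms are exact derivatives, and
with `I = ∫ f'²`, `N = ∫ |f|^q`, `D = ∫₀¹ √(1 - t^q)` the sum of squares is `I + k²(T - N) - 4kD ≥
0`. Optimising in `k` gives `I (T - N) ≥ 4D²`. A one-variable inequality in `N`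
(`rpow_mul_lt_one_of_ne_one`) then yields the sharp bound. Equality makes both squares vanish for `k
= 1`, and `f` solves the differential equation of the sine (`eqOn_genSin_of_deriv_eq`).

The constant is explicit because `∫ (sin')²` has three expressions, `(q/2)∫ sin^q`, `T - ∫ sin^q`
and `2D`, the last being a Beta value. -/

lemma setIntegral_Icc_eq_intervalIntegral {T : ℝ} (hT : 0 ≤ T) (f : ℝ → ℝ) :
    ∫ x in Set.Icc 0 T, f x = ∫ x in (0 : ℝ)..T, f x := by
  rw [integral_Icc_eq_integral_Ioc, intervalIntegral.integral_of_le hT]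

lemma intervalIntegrable_of_integrable {T : ℝ} (hT : 0 ≤ T) {w : ℝ → ℝ}
    (hw : Integrable w (intervalMeasure T)) : IntervalIntegrable w volume 0 T :=
  (intervalIntegrable_iff_integrableOn_Icc_of_le hT).2 hw

/-- Integration by parts for a primitive of an integrable function and a `C^1` function. -/
lemma integral_primitive_mul {T c : ℝ} (hT : 0 ≤ T) {w ψ ψ' : ℝ → ℝ}
    (hw : Integrable w (intervalMeasure T)) (hψ : ∀ x, HasDerivAt ψ (ψ' x) x)
    (hψ' : Continuous ψ') :
    ∫ x in Set.Icc 0 T, (c + ∫ t in (0 : ℝ)..x, w t) * ψ' x =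
      (c + ∫ t in (0 : ℝ)..T, w t) * ψ T - c * ψ 0 - ∫ x in Set.Icc 0 T, w x * ψ x := by
  have hwi := intervalIntegrable_of_integrable hT hw
  have hd : deriv ψ = ψ' := funext fun x => (hψ x).deriv
  have hF : AbsolutelyContinuousOnInterval (fun x => c + ∫ t in (0 : ℝ)..x, w t) 0 T :=
    (contDiff_const (c := c)).contDiffOn.absolutelyContinuousOnInterval.add
      (hwi.absolutelyContinuousOnInterval_intervalIntegral (by simp))
  have hψc : ContDiff ℝ 1 ψ := by
    rw [contDiff_one_iff_deriv, hd]
    exact ⟨fun x => (hψ x).differentiableAt, hψ'⟩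
  have key := hF.integral_mul_deriv_eq_deriv_mul hψc.contDiffOn.absolutelyContinuousOnInterval
  rw [hd] at key
  rw [setIntegral_Icc_eq_intervalIntegral hT, setIntegral_Icc_eq_intervalIntegral hT, key]
  -- `w` is only integrable, so the primitive has derivative `w` almost everywhere (Lebesgue
  -- differentiation), which is enough under the integral.
  have e : ∫ x in (0 : ℝ)..T, deriv (fun x => c + ∫ t in (0 : ℝ)..x, w t) x * ψ x =
      ∫ x in (0 : ℝ)..T, w x * ψ x := by
    apply intervalIntegral.integral_congr_ae
    filter_upwards [hwi.ae_hasDerivAt_integral] with x hx hx'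
    rw [((hx (Set.uIoc_subset_uIcc hx') 0 (by simp)).const_add c).deriv]
  rw [e]
  simp

lemma isWeakDeriv_primitive {T : ℝ} (hT : 0 ≤ T) (c : ℝ) {w : ℝ → ℝ}
    (hw : Integrable w (intervalMeasure T)) :
    IsWeakDeriv T (fun x => c + ∫ t in (0 : ℝ)..x, w t) w := by
  intro φ hφ
  rw [integral_primitive_mul hT hw
    (fun x => (hφ.contDiff.differentiable (by simp) x).hasDerivAt) hφ.deriv_continuous,
    hφ.eq_zero (x := T) (by simp), hφ.eq_zero (x := 0) (by simp)]
  ring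

/-- A function with an integrable weak derivative is a primitive of it. -/
lemma IsWeakDeriv.exists_primitive {T : ℝ} (hT : 0 < T) {f w : ℝ → ℝ} (h : IsWeakDeriv T f w)
    (hf : Integrable f (intervalMeasure T)) (hw : Integrable w (intervalMeasure T)) :
    ∃ c : ℝ, f =ᵐ[intervalMeasure T] fun x => c + ∫ t in (0 : ℝ)..x, w t := by
  have hwi := intervalIntegrable_of_integrable hT.le hw
  have hFi : Integrable (fun x => 0 + ∫ t in (0 : ℝ)..x, w t) (intervalMeasure T) := by
    apply ContinuousOn.integrableOn_Icc
    have := (hwi.absolutelyContinuousOnInterval_intervalIntegral (c := 0) (by simp)).continuousOn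
    rw [Set.uIcc_of_le hT.le] at this
    exact continuousOn_const.add this
  -- Subtracting the primitive leaves a function with zero weak derivative, hence a constant.
  have hsub := h.add ((isWeakDeriv_primitive hT.le 0 hw).smul (-1)) hf (hFi.smul (-1 : ℝ)) hw
    (hw.smul (-1 : ℝ))
  obtain ⟨c, hc⟩ := hsub.exists_const hT (Filter.Eventually.of_forall fun x => by simp)
    (hf.add (hFi.smul (-1 : ℝ)))
  refine ⟨c, ?_⟩
  filter_upwards [hc] with x hx
  simp only [Pi.add_apply, Pi.smul_apply, smul_eq_mul] at hx
  linarith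

variable {p T : ℝ} [Fact (1 < p)]

/-- Every `u ∈ W^{2,p}_D` has a `C^1` representative. -/
lemma SobolevD.exists_contDiff_representative (hT : 0 < T) (u : SobolevD p T) :
    ∃ f f' : ℝ → ℝ, Continuous f' ∧ (∀ x, HasDerivAt f (f' x) x) ∧
      toLp u =ᵐ[intervalMeasure T] f ∧ f 0 = 0 ∧ f T = 0 ∧
      ∫ x in (0 : ℝ)..T, f' x ^ 2 = - ∫ x in Set.Icc 0 T, f x * secondDeriv u x := by
  obtain ⟨v, hv, hw⟩ := secondDeriv_spec u
  set w := secondDeriv u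
  -- Extension by zero makes the primitive continuous, and its own primitive differentiable, on all
  -- of `ℝ`; no one-sided derivatives are then needed at the endpoints.
  let w₀ : ℝ → ℝ := (Set.Icc 0 T).indicator w
  have hw₀ : Integrable w₀ := (integrable_indicator_iff measurableSet_Icc).2 w.integrable
  have hww : w =ᵐ[intervalMeasure T] w₀ :=
    (indicator_ae_eq_restrict measurableSet_Icc).symm
  have hw' : IsWeakDeriv T v w₀ := hw.congr Filter.EventuallyEq.rfl hww
  obtain ⟨c, hc⟩ := hw'.exists_primitive hT v.integrable hw₀.integrableOn
  let f' : ℝ → ℝ := fun x => c + ∫ t in (0 : ℝ)..x, w₀ t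
  have hf'c : Continuous f' :=
    continuous_const.add (intervalIntegral.continuous_primitive
      (fun a b => hw₀.intervalIntegrable) 0)
  have hf'i : Integrable f' (intervalMeasure T) := hf'c.continuousOn.integrableOn_Icc
  have hv' : IsWeakDeriv T (toLp u) f' := hv.congr Filter.EventuallyEq.rfl hc
  obtain ⟨d, hd⟩ := hv'.exists_primitive hT (LpInt.integrable _) hf'i
  let f : ℝ → ℝ := fun x => d + ∫ t in (0 : ℝ)..x, f' t
  have hf : ∀ x, HasDerivAt f (f' x) x := fun x =>
    (intervalIntegral.integral_hasDerivAt_right (hf'c.intervalIntegrable _ _)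
      (hf'c.stronglyMeasurableAtFilter _ _) hf'c.continuousAt).const_add d
  have hfc : Continuous f := continuous_iff_continuousAt.2 fun x => (hf x).continuousAt
  obtain ⟨g, hg, hgc, hg0, hgT⟩ := vanishesAtEnds u
  have heq : Set.EqOn g f (Set.Icc 0 T) :=
    Measure.eqOn_Icc_of_ae_eq volume hT.ne (hg.symm.trans hd) hgc hfc.continuousOn
  have f0 : f 0 = 0 := by rw [← heq (Set.left_mem_Icc.2 hT.le), hg0]
  have fT : f T = 0 := by rw [← heq (Set.right_mem_Icc.2 hT.le), hgT]
  refine ⟨f, f', hf'c, hf, hd, f0, fT, ?_⟩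
  -- Here `f'` is the primitive and `f` the `C^1` factor; the boundary terms drop because `f`
  -- vanishes at both ends.
  have key := integral_primitive_mul (c := c) hT.le hw₀.integrableOn hf hf'c
  rw [f0, fT] at key
  rw [← setIntegral_Icc_eq_intervalIntegral hT.le]
  have e1 : ∫ x in Set.Icc 0 T, f x * w x = ∫ x in Set.Icc 0 T, w₀ x * f x := by
    apply integral_congr_ae
    filter_upwards [hww] with x hx
    rw [hx, mul_comm]
  rw [e1]
  simp only [mul_zero, sub_zero, zero_sub] at key
  rw [← key]
  simp only [sq]
  rfl

end Regularity

/-! ## The functions `sin_{2,q}` -/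

section GenSin

variable {q : ℝ}

/-- The right-hand side `√(1 - |y|^q)` of the differential equation of `sin_{2,q}`. -/
noncomputable def genSinSpeed (q y : ℝ) : ℝ := √(1 - |y| ^ q)

lemma continuous_genSinSpeed (hq : 1 < q) : Continuous (genSinSpeed q) := by
  unfold genSinSpeed
  have : Continuous fun y : ℝ => |y| ^ q :=
    continuous_abs.rpow_const fun _ => Or.inr (by linarith)
  fun_prop

lemma genSinSpeed_nonneg (q y : ℝ) : 0 ≤ genSinSpeed q y := Real.sqrt_nonneg _

lemma genSinSpeed_sq (hq : 1 < q) {y : ℝ} (hy : |y| ≤ 1) : genSinSpeed q y ^ 2 = 1 - |y| ^ q :=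
  Real.sq_sqrt (sub_nonneg.2 (Real.rpow_le_one (abs_nonneg y) hy (by linarith)))

lemma genSinSpeed_one : genSinSpeed q 1 = 0 := by simp [genSinSpeed]

lemma genSinSpeed_pos (hq : 1 < q) {y : ℝ} (hy : |y| < 1) : 0 < genSinSpeed q y :=
  Real.sqrt_pos.2 (sub_pos.2 (Real.rpow_lt_one (abs_nonneg y) hy (by linarith)))

lemma genSinSpeed_le_one (y : ℝ) : genSinSpeed q y ≤ 1 :=
  Real.sqrt_le_one.2 (by have := Real.rpow_nonneg (abs_nonneg y) q; linarith)

/-! ### The inverse function of the sine on `[0,1]` -/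

lemma genArcsin_eq_integral_inv {y : ℝ} (hy : 0 ≤ y) :
    genArcsin 2 q y = ∫ t in (0 : ℝ)..y, (genSinSpeed q t)⁻¹ := by
  apply intervalIntegral.integral_congr
  intro t ht
  rw [Set.uIcc_of_le hy] at ht
  simp only [genSinSpeed, abs_of_nonneg ht.1, one_div, Real.sqrt_eq_rpow]

lemma one_sub_le_genSinSpeed_sq (hq : 1 < q) {t : ℝ} (ht : t ∈ Set.Ioo (0 : ℝ) 1) :
    1 - t ≤ 1 - |t| ^ q := by
  rw [abs_of_pos ht.1]
  have := Real.rpow_le_rpow_of_exponent_ge ht.1 ht.2.le hq.le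
  rw [Real.rpow_one] at this
  linarith

/-- The only singularity is at `t = 1`. Since `t^q ≤ t` on `(0,1)`, the function is dominated by `(1
- t)^{-1/2}`, which is integrable. -/
lemma intervalIntegrable_inv_genSinSpeed (hq : 1 < q) :
    IntervalIntegrable (fun t => (genSinSpeed q t)⁻¹) volume 0 1 := by
  have h1 : IntervalIntegrable (fun t : ℝ => t ^ (-(1 / 2) : ℝ)) volume 0 1 :=
    intervalIntegral.intervalIntegrable_rpow' (by norm_num)
  have h2 : IntervalIntegrable (fun t : ℝ => (1 - t) ^ (-(1 / 2) : ℝ)) volume 0 1 := by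
    simpa using (h1.comp_sub_left 1).symm
  rw [intervalIntegrable_iff_integrableOn_Ioo_of_le zero_le_one] at h2 ⊢
  refine h2.mono' (continuous_genSinSpeed hq).measurable.inv.aestronglyMeasurable ?_
  refine (ae_restrict_iff' measurableSet_Ioo).2 (Filter.Eventually.of_forall fun t ht => ?_)
  have ht1 : 0 < 1 - t := sub_pos.2 ht.2
  rw [Real.norm_of_nonneg (inv_nonneg.2 (genSinSpeed_nonneg q t)), Real.rpow_neg ht1.le,
    ← Real.sqrt_eq_rpow]
  exact inv_anti₀ (Real.sqrt_pos.2 ht1) (Real.sqrt_le_sqrt (one_sub_le_genSinSpeed_sq hq ht))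

lemma genArcsin_zero : genArcsin 2 q 0 = 0 := by simp [genArcsin]

lemma genArcsin_one : genArcsin 2 q 1 = genPi 2 q / 2 := by simp [genArcsin, genPi]

lemma continuousOn_genArcsin (hq : 1 < q) : ContinuousOn (genArcsin 2 q) (Set.Icc 0 1) := by
  have h := intervalIntegral.continuousOn_primitive_interval
    ((intervalIntegrable_iff_integrableOn_Icc_of_le zero_le_one).1
      (intervalIntegrable_inv_genSinSpeed hq) |> fun h => by rwa [← Set.uIcc_of_le zero_le_one] at h)
  rw [Set.uIcc_of_le zero_le_one] at h
  exact h.congr fun y hy => genArcsin_eq_integral_inv hy.1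

/-- The integrand `1/√(1 - t^q)` is at least `1`. This expansion property gives strict monotonicity,
positivity of `π_{2,q}`, and the Lipschitz bound for the inverse. -/
lemma sub_le_genArcsin_sub (hq : 1 < q) {x y : ℝ} (hx : 0 ≤ x) (hxy : x ≤ y) (hy : y ≤ 1) :
    y - x ≤ genArcsin 2 q y - genArcsin 2 q x := by
  have hi := intervalIntegrable_inv_genSinSpeed hq
  have hi1 : IntervalIntegrable (fun t => (genSinSpeed q t)⁻¹) volume 0 x :=
    hi.mono_set (by rw [Set.uIcc_of_le hx, Set.uIcc_of_le zero_le_one]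
                    exact Set.Icc_subset_Icc_right (hxy.trans hy))
  have hi2 : IntervalIntegrable (fun t => (genSinSpeed q t)⁻¹) volume x y :=
    hi.mono_set (by rw [Set.uIcc_of_le hxy, Set.uIcc_of_le zero_le_one]
                    exact Set.Icc_subset_Icc hx hy)
  rw [genArcsin_eq_integral_inv hx, genArcsin_eq_integral_inv (hx.trans hxy),
    ← intervalIntegral.integral_add_adjacent_intervals hi1 hi2, add_sub_cancel_left]
  calc y - x = ∫ _ in x..y, (1 : ℝ) := by simp
    _ ≤ _ := by
      apply intervalIntegral.integral_mono_on_of_le_Ioo hxy (by simp) hi2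
      intro t ht
      have h1 : |t| < 1 := by rw [abs_of_pos (hx.trans_lt ht.1)]; exact ht.2.trans_le hy
      exact (one_le_inv₀ (genSinSpeed_pos hq h1)).2 (genSinSpeed_le_one t)

lemma strictMonoOn_genArcsin (hq : 1 < q) : StrictMonoOn (genArcsin 2 q) (Set.Icc 0 1) :=
  fun x hx y hy hxy => by
    have := sub_le_genArcsin_sub hq hx.1 hxy.le hy.2
    linarith

lemma genPi_pos (hq : 1 < q) : 0 < genPi 2 q := by
  have := sub_le_genArcsin_sub hq le_rfl zero_le_one le_rfl
  rw [genArcsin_one, genArcsin_zero] at this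
  linarith

lemma hasDerivAt_genArcsin (hq : 1 < q) {y : ℝ} (hy : y ∈ Set.Ioo (0 : ℝ) 1) :
    HasDerivAt (genArcsin 2 q) (genSinSpeed q y)⁻¹ y := by
  have hpos : 0 < genSinSpeed q y := genSinSpeed_pos hq (by rw [abs_of_pos hy.1]; exact hy.2)
  have hd : HasDerivAt (fun y => ∫ t in (0 : ℝ)..y, (genSinSpeed q t)⁻¹) (genSinSpeed q y)⁻¹ y := by
    apply intervalIntegral.integral_hasDerivAt_right
    · exact (intervalIntegrable_inv_genSinSpeed hq).mono_set (by
        rw [Set.uIcc_of_le hy.1.le, Set.uIcc_of_le zero_le_one]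
        exact Set.Icc_subset_Icc_right hy.2.le)
    · exact (continuous_genSinSpeed hq).measurable.inv.stronglyMeasurable.stronglyMeasurableAtFilter
    · exact (continuous_genSinSpeed hq).continuousAt.inv₀ hpos.ne'
  apply hd.congr_of_eventuallyEq
  filter_upwards [Ioi_mem_nhds hy.1] with z hz
  exact genArcsin_eq_integral_inv (le_of_lt hz)

lemma image_genArcsin (hq : 1 < q) {x : ℝ} (hx : x ∈ Set.Icc 0 (genPi 2 q / 2)) :
    x ∈ genArcsin 2 q '' Set.Icc 0 1 := by
  have := intermediate_value_Icc zero_le_one (continuousOn_genArcsin hq)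
  rw [genArcsin_one, genArcsin_zero] at this
  exact this hx

lemma invFunOn_genArcsin_zero (hq : 1 < q) :
    Function.invFunOn (genArcsin 2 q) (Set.Icc 0 1) 0 = 0 := by
  have := (strictMonoOn_genArcsin hq).injOn.leftInvOn_invFunOn (x := 0) (by simp)
  rwa [genArcsin_zero] at this

/-- Reduction modulo the period does nothing on `[0, π)`. At `x = π` the quotient `1/2` rounds up to
`1` and the reduced point is `-π`, but there both sides are `0`. -/
lemma genSin_eq_invFunOn (hq : 1 < q) {x : ℝ} (hx : x ∈ Set.Icc 0 (genPi 2 q)) :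
    genSin 2 q x = Function.invFunOn (genArcsin 2 q) (Set.Icc 0 1) (min x (genPi 2 q - x)) := by
  have hT := genPi_pos hq
  unfold genSin
  obtain hlt | rfl := hx.2.lt_or_eq
  · have hr : round (x / (2 * genPi 2 q)) = 0 := by
      rw [round_eq_zero_iff]
      constructor
      · have : 0 ≤ x / (2 * genPi 2 q) := div_nonneg hx.1 (by linarith)
        linarith
      · rw [div_lt_iff₀ (by linarith)]
        linarith
    simp only [hr, Int.cast_zero, mul_zero, sub_zero, abs_of_nonneg hx.1]
    obtain h0 | h0 := hx.1.lt_or_eq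
    · simp [sign_pos h0]
    · simp [← h0, hT.le, invFunOn_genArcsin_zero hq]
  · have hr : round (genPi 2 q / (2 * genPi 2 q)) = 1 := by
      have : genPi 2 q / (2 * genPi 2 q) = 1 / 2 := by field_simp
      rw [this, round_eq]
      norm_num
    have : genPi 2 q - 2 * genPi 2 q * ((1 : ℤ) : ℝ) = - genPi 2 q := by push_cast; ring
    simp only [hr, this, abs_neg, abs_of_pos hT, sub_self, min_eq_right hT.le,
      invFunOn_genArcsin_zero hq, mul_zero]

lemma genSin_symm (hq : 1 < q) {x : ℝ} (hx : x ∈ Set.Icc 0 (genPi 2 q)) :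
    genSin 2 q (genPi 2 q - x) = genSin 2 q x := by
  rw [genSin_eq_invFunOn hq hx, genSin_eq_invFunOn hq ⟨by linarith [hx.2], by linarith [hx.1]⟩,
    min_comm, sub_sub_cancel]

lemma genSin_mem_and_genArcsin_genSin (hq : 1 < q) {x : ℝ} (hx : x ∈ Set.Icc 0 (genPi 2 q / 2)) :
    genSin 2 q x ∈ Set.Icc 0 1 ∧ genArcsin 2 q (genSin 2 q x) = x := by
  have hT := genPi_pos hq
  rw [genSin_eq_invFunOn hq ⟨hx.1, by linarith [hx.2]⟩, min_eq_left (by linarith [hx.2])]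
  exact ⟨Function.invFunOn_mem (image_genArcsin hq hx), Function.invFunOn_eq (image_genArcsin hq hx)⟩

lemma genArcsin_genSin (hq : 1 < q) {x : ℝ} (hx : x ∈ Set.Icc 0 (genPi 2 q / 2)) :
    genArcsin 2 q (genSin 2 q x) = x := (genSin_mem_and_genArcsin_genSin hq hx).2

lemma genSin_mem_Icc_of_le_half (hq : 1 < q) {x : ℝ} (hx : x ∈ Set.Icc 0 (genPi 2 q / 2)) :
    genSin 2 q x ∈ Set.Icc 0 1 := (genSin_mem_and_genArcsin_genSin hq hx).1

lemma genSin_eq_of_genArcsin_eq (hq : 1 < q) {x y : ℝ} (hx : x ∈ Set.Icc 0 (genPi 2 q / 2))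
    (hy : y ∈ Set.Icc (0 : ℝ) 1) (h : genArcsin 2 q y = x) : genSin 2 q x = y :=
  (strictMonoOn_genArcsin hq).injOn (genSin_mem_Icc_of_le_half hq hx) hy
    (by rw [genArcsin_genSin hq hx, h])

lemma genSin_zero (hq : 1 < q) : genSin 2 q 0 = 0 :=
  genSin_eq_of_genArcsin_eq hq ⟨le_rfl, by linarith [genPi_pos hq]⟩ (by simp) genArcsin_zero

lemma genSin_genPi (hq : 1 < q) : genSin 2 q (genPi 2 q) = 0 := by
  have := genSin_symm hq (x := 0) ⟨le_rfl, (genPi_pos hq).le⟩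
  rwa [sub_zero, genSin_zero hq] at this

lemma genSin_half (hq : 1 < q) : genSin 2 q (genPi 2 q / 2) = 1 :=
  genSin_eq_of_genArcsin_eq hq ⟨by linarith [genPi_pos hq], le_rfl⟩ (by simp) genArcsin_one

lemma genSin_mem_Icc (hq : 1 < q) {x : ℝ} (hx : x ∈ Set.Icc 0 (genPi 2 q)) :
    genSin 2 q x ∈ Set.Icc 0 1 := by
  obtain h | h := le_total x (genPi 2 q / 2)
  · exact genSin_mem_Icc_of_le_half hq ⟨hx.1, h⟩
  · rw [← genSin_symm hq hx]
    exact genSin_mem_Icc_of_le_half hq ⟨by linarith [hx.2], by linarith⟩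

/-- The inverse of an expanding map is 1-Lipschitz. -/
lemma continuousOn_genSin_half (hq : 1 < q) :
    ContinuousOn (genSin 2 q) (Set.Icc 0 (genPi 2 q / 2)) := by
  apply LipschitzOnWith.continuousOn (K := 1)
  apply LipschitzOnWith.of_dist_le_mul
  intro x hx y hy
  wlog hxy : genSin 2 q x ≤ genSin 2 q y generalizing x y
  · rw [dist_comm, dist_comm x y]
    exact this y hy x hx (le_of_not_ge hxy)
  have := sub_le_genArcsin_sub hq (genSin_mem_Icc_of_le_half hq hx).1 hxy
    (genSin_mem_Icc_of_le_half hq hy).2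
  rw [genArcsin_genSin hq hx, genArcsin_genSin hq hy] at this
  rw [dist_comm, dist_comm x y, Real.dist_eq, Real.dist_eq, abs_of_nonneg (sub_nonneg.2 hxy)]
  simpa using this.trans (le_abs_self _)

lemma continuousOn_genSin (hq : 1 < q) : ContinuousOn (genSin 2 q) (Set.Icc 0 (genPi 2 q)) := by
  have hT := genPi_pos hq
  have h2 : ContinuousOn (genSin 2 q) (Set.Icc (genPi 2 q / 2) (genPi 2 q)) := by
    have h := (continuousOn_genSin_half hq).comp (s := Set.Icc (genPi 2 q / 2) (genPi 2 q))
      (f := fun x => genPi 2 q - x) (by fun_prop)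
      fun x hx => ⟨by linarith [hx.2], by linarith [hx.1]⟩
    exact h.congr fun x hx => (genSin_symm hq ⟨by linarith [hx.1], hx.2⟩).symm
  rw [← Set.Icc_union_Icc_eq_Icc (b := genPi 2 q / 2) (by linarith) (by linarith)]
  exact (continuousOn_genSin_half hq).union_of_isClosed h2 isClosed_Icc isClosed_Icc

lemma genSin_mem_Ioo (hq : 1 < q) {x : ℝ} (hx : x ∈ Set.Ioo 0 (genPi 2 q / 2)) :
    genSin 2 q x ∈ Set.Ioo 0 1 := by
  have h := genSin_mem_Icc_of_le_half hq (Set.Ioo_subset_Icc_self hx)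
  have e := genArcsin_genSin hq (Set.Ioo_subset_Icc_self hx)
  refine ⟨h.1.lt_of_ne fun h0 => ?_, h.2.lt_of_ne fun h1 => ?_⟩
  · rw [← h0, genArcsin_zero] at e
    exact hx.1.ne e
  · rw [h1, genArcsin_one] at e
    exact hx.2.ne' e

/-- Inverse function rule. The point `π/2` is left out because the derivative of the inverse
function blows up at the value `1`. -/
lemma hasDerivAt_genSin (hq : 1 < q) {x : ℝ} (hx : x ∈ Set.Ioo 0 (genPi 2 q / 2)) :
    HasDerivAt (genSin 2 q) (genSinSpeed q (genSin 2 q x)) x := by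
  have hm := genSin_mem_Ioo hq hx
  have hpos : 0 < genSinSpeed q (genSin 2 q x) :=
    genSinSpeed_pos hq (by rw [abs_of_pos hm.1]; exact hm.2)
  have h := HasDerivAt.of_local_left_inverse
    ((continuousOn_genSin_half hq).continuousAt (Icc_mem_nhds hx.1 hx.2))
    (hasDerivAt_genArcsin hq hm) (inv_ne_zero hpos.ne') (by
      filter_upwards [Icc_mem_nhds hx.1 hx.2] with y hy using genArcsin_genSin hq hy)
  rwa [inv_inv] at h

end GenSin

/-! ## The derivatives of `sin_{2,q}` -/

section GenSinDeriv

variable {q : ℝ}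

/-- Integration by parts on `[a,b]` with countably many exceptional points. -/
lemma integral_mul_deriv_off_countable {a b : ℝ} (hab : a ≤ b) {s : Set ℝ} (hs : s.Countable)
    {u v u' v' : ℝ → ℝ} (hu : ContinuousOn u (Set.Icc a b)) (hv : ContinuousOn v (Set.Icc a b))
    (hu' : ContinuousOn u' (Set.Icc a b)) (hv' : ContinuousOn v' (Set.Icc a b))
    (hud : ∀ x ∈ Set.Ioo a b \ s, HasDerivAt u (u' x) x)
    (hvd : ∀ x ∈ Set.Ioo a b \ s, HasDerivAt v (v' x) x) :
    ∫ x in a..b, u x * v' x = u b * v b - u a * v a - ∫ x in a..b, u' x * v x := by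
  have h1 : IntervalIntegrable (fun x => u' x * v x) volume a b :=
    (hu'.mul hv).intervalIntegrable_of_Icc hab
  have h2 : IntervalIntegrable (fun x => u x * v' x) volume a b :=
    (hu.mul hv').intervalIntegrable_of_Icc hab
  have := integral_eq_of_hasDerivAt_off_countable_of_le (fun x => u x * v x)
    (fun x => u' x * v x + u x * v' x) hab hs (hu.mul hv)
    (fun x hx => (hud x hx).mul (hvd x hx)) (h1.add h2)
  rw [intervalIntegral.integral_add h1 h2] at this
  linarith

/-- The derivative of `sin_{2,q}` on `[0, π_{2,q}]`. -/
noncomputable def genSinDeriv (q x : ℝ) : ℝ :=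
  if x ≤ genPi 2 q / 2 then genSinSpeed q (genSin 2 q x) else -genSinSpeed q (genSin 2 q x)

/-- The second derivative of `sin_{2,q}` on `[0, π_{2,q}]`. -/
noncomputable def genSinDeriv₂ (q x : ℝ) : ℝ := -(q / 2) * genSin 2 q x ^ (q - 1)

lemma genSinDeriv_of_le {x : ℝ} (hx : x ≤ genPi 2 q / 2) :
    genSinDeriv q x = genSinSpeed q (genSin 2 q x) := if_pos hx

lemma genSinDeriv_of_ge (hq : 1 < q) {x : ℝ} (hx : genPi 2 q / 2 ≤ x) :
    genSinDeriv q x = -genSinSpeed q (genSin 2 q x) := by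
  obtain h | rfl := hx.lt_or_eq
  · exact if_neg (not_le.2 h)
  · rw [genSinDeriv_of_le le_rfl, genSin_half hq, genSinSpeed_one, neg_zero]

lemma genSinDeriv_symm (hq : 1 < q) {x : ℝ} (hx : x ∈ Set.Icc 0 (genPi 2 q)) :
    genSinDeriv q (genPi 2 q - x) = -genSinDeriv q x := by
  obtain h | h := le_total x (genPi 2 q / 2)
  · rw [genSinDeriv_of_le h, genSinDeriv_of_ge hq (by linarith), genSin_symm hq hx]
  · rw [genSinDeriv_of_ge hq h, genSinDeriv_of_le (by linarith), genSin_symm hq hx, neg_neg]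

lemma genSinDeriv₂_symm (hq : 1 < q) {x : ℝ} (hx : x ∈ Set.Icc 0 (genPi 2 q)) :
    genSinDeriv₂ q (genPi 2 q - x) = genSinDeriv₂ q x := by
  simp only [genSinDeriv₂, genSin_symm hq hx]

lemma genSinDeriv_sq (hq : 1 < q) {x : ℝ} (hx : x ∈ Set.Icc 0 (genPi 2 q)) :
    genSinDeriv q x ^ 2 = 1 - genSin 2 q x ^ q := by
  have hm := genSin_mem_Icc hq hx
  have := genSinSpeed_sq hq (y := genSin 2 q x) (by rw [abs_of_nonneg hm.1]; exact hm.2)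
  rw [abs_of_nonneg hm.1] at this
  unfold genSinDeriv
  split_ifs
  · exact this
  · rw [neg_sq, this]

lemma continuousOn_genSinDeriv (hq : 1 < q) :
    ContinuousOn (genSinDeriv q) (Set.Icc 0 (genPi 2 q)) := by
  have hT := genPi_pos hq
  have hc : ContinuousOn (fun x => genSinSpeed q (genSin 2 q x)) (Set.Icc 0 (genPi 2 q)) :=
    (continuous_genSinSpeed hq).comp_continuousOn (continuousOn_genSin hq)
  have h1 : ContinuousOn (genSinDeriv q) (Set.Icc 0 (genPi 2 q / 2)) :=
    (hc.mono (Set.Icc_subset_Icc_right (by linarith))).congr fun x hx => genSinDeriv_of_le hx.2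
  have h2 : ContinuousOn (genSinDeriv q) (Set.Icc (genPi 2 q / 2) (genPi 2 q)) :=
    (hc.neg.mono (Set.Icc_subset_Icc_left (by linarith))).congr
      fun x hx => genSinDeriv_of_ge hq hx.1
  rw [← Set.Icc_union_Icc_eq_Icc (b := genPi 2 q / 2) (by linarith) (by linarith)]
  exact h1.union_of_isClosed h2 isClosed_Icc isClosed_Icc

lemma continuousOn_genSinDeriv₂ (hq : 1 < q) :
    ContinuousOn (genSinDeriv₂ q) (Set.Icc 0 (genPi 2 q)) :=
  continuousOn_const.mul
    ((continuousOn_genSin hq).rpow_const fun _ _ => Or.inr (by linarith))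

lemma HasDerivAt.of_comp_const_sub {T a c : ℝ} {f g : ℝ → ℝ}
    (h : HasDerivAt f c (T - a)) (hg : ∀ᶠ x in nhds a, g x = f (T - x)) : HasDerivAt g (-c) a :=
  HasDerivAt.congr_of_eventuallyEq (by simpa using h.comp_const_sub T a) hg

/-- The right half follows from the left one by reflection in `π/2`. The midpoint can be omitted,
since later integrations by parts allow a countable exceptional set. -/
lemma hasDerivAt_genSin_of_ne (hq : 1 < q) {x : ℝ}
    (hx : x ∈ Set.Ioo 0 (genPi 2 q) \ {genPi 2 q / 2}) :
    HasDerivAt (genSin 2 q) (genSinDeriv q x) x := by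
  obtain ⟨hx, hne⟩ := hx
  obtain h | h := lt_or_gt_of_ne hne
  · rw [genSinDeriv_of_le h.le]
    exact hasDerivAt_genSin hq ⟨hx.1, h⟩
  · rw [genSinDeriv_of_ge hq h.le, ← genSin_symm hq (Set.Ioo_subset_Icc_self hx)]
    apply (hasDerivAt_genSin hq (x := genPi 2 q - x)
      ⟨by linarith [hx.2], by linarith⟩).of_comp_const_sub
    filter_upwards [Icc_mem_nhds hx.1 hx.2] with y hy using (genSin_symm hq hy).symm

lemma hasDerivAt_genSinSpeed (hq : 1 < q) {y : ℝ} (hy : y ∈ Set.Ioo (0 : ℝ) 1) :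
    HasDerivAt (genSinSpeed q) (-(q / 2) * y ^ (q - 1) * (genSinSpeed q y)⁻¹) y := by
  have hpos : 0 < genSinSpeed q y := genSinSpeed_pos hq (by rw [abs_of_pos hy.1]; exact hy.2)
  have h1 : HasDerivAt (fun y : ℝ => 1 - y ^ q) (-(q * y ^ (q - 1))) y :=
    (Real.hasDerivAt_rpow_const (Or.inl hy.1.ne')).const_sub 1
  have hyq : 1 - y ^ q ≠ 0 := (sub_pos.2 (Real.rpow_lt_one hy.1.le hy.2 (by linarith))).ne'
  have h2 := h1.sqrt hyq
  have e : genSinSpeed q y = √(1 - y ^ q) := by rw [genSinSpeed, abs_of_pos hy.1]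
  have h3 : HasDerivAt (genSinSpeed q) (-(q * y ^ (q - 1)) / (2 * √(1 - y ^ q))) y := by
    apply h2.congr_of_eventuallyEq
    filter_upwards [Ioi_mem_nhds hy.1] with z hz
    rw [genSinSpeed, abs_of_pos hz]
  convert h3 using 1
  rw [← e]
  field_simp

lemma hasDerivAt_genSinDeriv_of_ne (hq : 1 < q) {x : ℝ}
    (hx : x ∈ Set.Ioo 0 (genPi 2 q) \ {genPi 2 q / 2}) :
    HasDerivAt (genSinDeriv q) (genSinDeriv₂ q x) x := by
  have key : ∀ x ∈ Set.Ioo 0 (genPi 2 q / 2), HasDerivAt (genSinDeriv q) (genSinDeriv₂ q x) x := by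
    intro x hx
    have hm := genSin_mem_Ioo hq hx
    have hpos : 0 < genSinSpeed q (genSin 2 q x) :=
      genSinSpeed_pos hq (by rw [abs_of_pos hm.1]; exact hm.2)
    have h := (hasDerivAt_genSinSpeed hq hm).comp x (hasDerivAt_genSin hq hx)
    -- The speed from the chain rule cancels the square root in the denominator of its derivative,
    -- leaving `-(q/2) sin^{q-1}`.
    rw [inv_mul_cancel_right₀ hpos.ne'] at h
    apply h.congr_of_eventuallyEq
    filter_upwards [Iio_mem_nhds hx.2] with y hy using genSinDeriv_of_le (le_of_lt hy)
  obtain ⟨hx, hne⟩ := hx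
  obtain h | h := lt_or_gt_of_ne hne
  · exact key x ⟨hx.1, h⟩
  · rw [← genSinDeriv₂_symm hq (Set.Ioo_subset_Icc_self hx)]
    have := (key (genPi 2 q - x) ⟨by linarith [hx.2], by linarith⟩).neg
    rw [← neg_neg (genSinDeriv₂ q _)]
    apply HasDerivAt.of_comp_const_sub this
    filter_upwards [Icc_mem_nhds hx.1 hx.2] with y hy
    simp [genSinDeriv_symm hq hy]

lemma isWeakDeriv_of_hasDerivAt_off_countable {T : ℝ} (hT : 0 ≤ T) {s : Set ℝ} (hs : s.Countable)
    {u u' : ℝ → ℝ} (hu : ContinuousOn u (Set.Icc 0 T)) (hu' : ContinuousOn u' (Set.Icc 0 T))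
    (hud : ∀ x ∈ Set.Ioo 0 T \ s, HasDerivAt u (u' x) x) : IsWeakDeriv T u u' := by
  intro φ hφ
  rw [setIntegral_Icc_eq_intervalIntegral hT, setIntegral_Icc_eq_intervalIntegral hT,
    integral_mul_deriv_off_countable hT hs hu hφ.contDiff.continuous.continuousOn hu'
      hφ.deriv_continuous.continuousOn hud
      fun x _ => (hφ.contDiff.differentiable (by simp) x).hasDerivAt,
    hφ.eq_zero (x := T) (by simp), hφ.eq_zero (x := 0) (by simp)]
  ring

lemma isWeakDeriv_genSin (hq : 1 < q) :
    IsWeakDeriv (genPi 2 q) (genSin 2 q) (genSinDeriv q) :=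
  isWeakDeriv_of_hasDerivAt_off_countable (genPi_pos hq).le (Set.countable_singleton _)
    (continuousOn_genSin hq) (continuousOn_genSinDeriv hq)
    fun _ => hasDerivAt_genSin_of_ne hq

lemma isWeakDeriv_genSinDeriv (hq : 1 < q) :
    IsWeakDeriv (genPi 2 q) (genSinDeriv q) (genSinDeriv₂ q) :=
  isWeakDeriv_of_hasDerivAt_off_countable (genPi_pos hq).le (Set.countable_singleton _)
    (continuousOn_genSinDeriv hq) (continuousOn_genSinDeriv₂ hq)
    fun _ => hasDerivAt_genSinDeriv_of_ne hq

lemma continuousOn_genSin_rpow (hq : 1 < q) :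
    ContinuousOn (fun x => genSin 2 q x ^ q) (Set.Icc 0 (genPi 2 q)) :=
  (continuousOn_genSin hq).rpow_const fun _ _ => Or.inr (by linarith)

/-- `∫ (sin')² = (q/2) ∫ sin^q`. -/
lemma integral_genSinDeriv_sq (hq : 1 < q) :
    ∫ x in (0 : ℝ)..genPi 2 q, genSinDeriv q x ^ 2 =
      q / 2 * ∫ x in (0 : ℝ)..genPi 2 q, genSin 2 q x ^ q := by
  have hT := genPi_pos hq
  -- Integrate `sin' · sin'` by parts; the boundary terms vanish and `-sin'' sin = (q/2) sin^q`.
  have h := integral_mul_deriv_off_countable hT.le (Set.countable_singleton (genPi 2 q / 2))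
    (continuousOn_genSinDeriv hq) (continuousOn_genSin hq) (continuousOn_genSinDeriv₂ hq)
    (continuousOn_genSinDeriv hq) (fun _ => hasDerivAt_genSinDeriv_of_ne hq)
    (fun _ => hasDerivAt_genSin_of_ne hq)
  rw [genSin_zero hq, genSin_genPi hq] at h
  simp only [sq, h]
  rw [← intervalIntegral.integral_const_mul, mul_zero, mul_zero, sub_zero, zero_sub,
    ← intervalIntegral.integral_neg]
  apply intervalIntegral.integral_congr
  intro x hx
  rw [Set.uIcc_of_le hT.le] at hx
  have hm := genSin_mem_Icc hq hx
  simp only [genSinDeriv₂]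
  have : genSin 2 q x ^ q = genSin 2 q x ^ (q - 1) * genSin 2 q x := by
    rw [← Real.rpow_add_one' hm.1 (by linarith), sub_add_cancel]
  rw [this]
  ring

/-- `∫ (sin')² = π - ∫ sin^q`. -/
lemma integral_genSinDeriv_sq' (hq : 1 < q) :
    ∫ x in (0 : ℝ)..genPi 2 q, genSinDeriv q x ^ 2 =
      genPi 2 q - ∫ x in (0 : ℝ)..genPi 2 q, genSin 2 q x ^ q := by
  have hT := genPi_pos hq
  have : ∫ x in (0 : ℝ)..genPi 2 q, genSinDeriv q x ^ 2 =
      ∫ x in (0 : ℝ)..genPi 2 q, (1 - genSin 2 q x ^ q) := by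
    apply intervalIntegral.integral_congr
    intro x hx
    rw [Set.uIcc_of_le hT.le] at hx
    exact genSinDeriv_sq hq hx
  rw [this, intervalIntegral.integral_sub (by simp)
    ((continuousOn_genSin_rpow hq).intervalIntegrable_of_Icc hT.le)]
  simp

lemma hasDerivAt_integral_genSinSpeed (hq : 1 < q) (y : ℝ) :
    HasDerivAt (fun y => ∫ t in (0 : ℝ)..y, genSinSpeed q t) (genSinSpeed q y) y :=
  intervalIntegral.integral_hasDerivAt_right ((continuous_genSinSpeed hq).intervalIntegrable _ _)
    ((continuous_genSinSpeed hq).stronglyMeasurableAtFilter _ _)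
    (continuous_genSinSpeed hq).continuousAt

/-- `∫ (sin')² = 2 ∫₀¹ √(1 - t^q) dt`. -/
lemma integral_genSinDeriv_sq_eq_two_mul (hq : 1 < q) :
    ∫ x in (0 : ℝ)..genPi 2 q, genSinDeriv q x ^ 2 =
      2 * ∫ t in (0 : ℝ)..1, genSinSpeed q t := by
  have hT := genPi_pos hq
  set T := genPi 2 q with hTdef
  have hc : ContinuousOn (fun x => genSinDeriv q x ^ 2) (Set.Icc 0 T) :=
    (continuousOn_genSinDeriv hq).pow 2
  have hi1 : IntervalIntegrable (fun x => genSinDeriv q x ^ 2) volume 0 (T / 2) :=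
    (hc.mono (Set.Icc_subset_Icc_right (by linarith))).intervalIntegrable_of_Icc (by linarith)
  have hi2 : IntervalIntegrable (fun x => genSinDeriv q x ^ 2) volume (T / 2) T :=
    (hc.mono (Set.Icc_subset_Icc_left (by linarith))).intervalIntegrable_of_Icc (by linarith)
  have e2 : ∫ x in (T / 2)..T, genSinDeriv q x ^ 2 = ∫ x in (0 : ℝ)..(T / 2), genSinDeriv q x ^ 2 := by
    have := intervalIntegral.integral_comp_sub_left (fun x => genSinDeriv q x ^ 2) T
      (a := 0) (b := T / 2)
    rw [sub_zero, sub_half] at this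
    rw [← this]
    apply intervalIntegral.integral_congr
    intro x hx
    rw [Set.uIcc_of_le (by linarith)] at hx
    simp only [hTdef]
    rw [genSinDeriv_symm hq ⟨hx.1, by linarith [hx.2]⟩, neg_sq]
  -- On the rising half `sin' = √(1 - sin^q)`, so `(sin')²` is the derivative of the primitive of
  -- the speed evaluated at `sin x`.
  have e1 : ∫ x in (0 : ℝ)..(T / 2), genSinDeriv q x ^ 2 = ∫ t in (0 : ℝ)..1, genSinSpeed q t := by
    have h := intervalIntegral.integral_eq_sub_of_hasDerivAt_of_le
      (f := fun x => ∫ t in (0 : ℝ)..genSin 2 q x, genSinSpeed q t)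
      (f' := fun x => genSinDeriv q x ^ 2) (a := 0) (b := T / 2) (by linarith)
      (ContinuousOn.comp (g := fun y => ∫ t in (0 : ℝ)..y, genSinSpeed q t) (t := Set.univ)
        (fun y _ => (hasDerivAt_integral_genSinSpeed hq y).continuousAt.continuousWithinAt)
        (continuousOn_genSin_half hq) (fun _ _ => trivial))
      (fun x hx => by
        rw [genSinDeriv_of_le hx.2.le, sq]
        exact (hasDerivAt_integral_genSinSpeed hq _).comp x (hasDerivAt_genSin hq hx)) hi1
    rw [h, hTdef, genSin_half hq, genSin_zero hq]
    simp
  rw [← intervalIntegral.integral_add_adjacent_intervals hi1 hi2, e2, e1]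
  ring

lemma integral_genSinSpeed_pos (hq : 1 < q) : 0 < ∫ t in (0 : ℝ)..1, genSinSpeed q t := by
  apply intervalIntegral.intervalIntegral_pos_of_pos_on
    ((continuous_genSinSpeed hq).intervalIntegrable _ _) _ zero_lt_one
  intro t ht
  exact genSinSpeed_pos hq (by rw [abs_of_pos ht.1]; exact ht.2)

/-- `2 ∫₀¹ √(1 - t^q) dt = B(1/2, (q+1)/q)`. -/
lemma two_mul_integral_genSinSpeed (hq : 1 < q) :
    2 * ∫ t in (0 : ℝ)..1, genSinSpeed q t = ProbabilityTheory.beta (1 / 2) ((q + 1) / q) := by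
  have hq0 : 0 < q := by linarith
  have hb : ProbabilityTheory.beta (1 / q) (3 / 2) =
      ∫ x in (0 : ℝ)..1, x ^ (1 / q - 1) * (1 - x) ^ (1 / 2 : ℝ) := by
    rw [ProbabilityTheory.beta_eq_betaIntegralReal _ _ (by positivity) (by norm_num),
      Complex.betaIntegral]
    have : ∀ x ∈ Set.uIcc (0 : ℝ) 1, (x : ℂ) ^ (((1 / q : ℝ) : ℂ) - 1) *
        (1 - (x : ℂ)) ^ (((3 / 2 : ℝ) : ℂ) - 1) =
        ((x ^ (1 / q - 1) * (1 - x) ^ (1 / 2 : ℝ) : ℝ) : ℂ) := by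
      intro x hx
      rw [Set.uIcc_of_le zero_le_one] at hx
      rw [Complex.ofReal_mul, Complex.ofReal_cpow hx.1, Complex.ofReal_cpow (sub_nonneg.2 hx.2)]
      push_cast
      norm_num
    rw [intervalIntegral.integral_congr this, intervalIntegral.integral_ofReal, Complex.ofReal_re]
  have hs : ∫ t in (0 : ℝ)..1, genSinSpeed q t =
      1 / q * ∫ x in (0 : ℝ)..1, x ^ (1 / q - 1) * (1 - x) ^ (1 / 2 : ℝ) := by
    -- Substitution `t = x^{1/q}` on the whole half-line: the real square root is `0` at negative
    -- arguments, so the speed vanishes for `t > 1` and both integrals reduce to `(0,1]`.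
    have h := integral_comp_rpow_Ioi_of_pos (g := genSinSpeed q) (p := 1 / q) (by positivity)
    have hz : ∀ t : ℝ, t ∈ Set.Ioi 0 \ Set.Ioc 0 1 → genSinSpeed q t = 0 := by
      intro t ht
      have ht1 : 1 < t := by
        by_contra hcon
        exact ht.2 ⟨ht.1, not_lt.1 hcon⟩
      apply Real.sqrt_eq_zero_of_nonpos
      have := Real.one_lt_rpow (x := |t|) (z := q) (ht1.trans_le (le_abs_self t)) hq0
      linarith
    rw [intervalIntegral.integral_of_le zero_le_one, intervalIntegral.integral_of_le zero_le_one,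
      ← setIntegral_eq_of_subset_of_forall_sdiff_eq_zero measurableSet_Ioi
        Set.Ioc_subset_Ioi_self hz, ← h, ← integral_const_mul,
      setIntegral_eq_of_subset_of_forall_sdiff_eq_zero (s := Set.Ioc 0 1) measurableSet_Ioi
        Set.Ioc_subset_Ioi_self]
    · apply setIntegral_congr_fun measurableSet_Ioc
      intro x hx
      have : (|x ^ (1 / q)|) ^ q = x := by
        rw [abs_of_nonneg (Real.rpow_nonneg hx.1.le _), ← Real.rpow_mul hx.1.le,
          one_div_mul_cancel hq0.ne', Real.rpow_one]
      simp only [genSinSpeed, this, smul_eq_mul, ← Real.sqrt_eq_rpow]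
      ring
    · intro x hx
      have hx1 : 1 < x := by
        by_contra hcon
        exact hx.2 ⟨hx.1, not_lt.1 hcon⟩
      rw [hz, smul_zero]
      have := Real.one_lt_rpow (x := x) (z := 1 / q) hx1 (by positivity)
      exact ⟨zero_lt_one.trans this, fun h => absurd h.2 (not_le.2 this)⟩
  rw [hs, ← hb, ProbabilityTheory.beta, ProbabilityTheory.beta]
  -- The substitution produced `(2/q) B(1/q, 3/2)`; `Γ(s+1) = sΓ(s)` moves the unit shift from one
  -- argument to the other.
  have g1 : Real.Gamma (3 / 2) = 1 / 2 * Real.Gamma (1 / 2) := by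
    rw [← Real.Gamma_add_one (by norm_num)]
    norm_num
  have g2 : Real.Gamma ((q + 1) / q) = 1 / q * Real.Gamma (1 / q) := by
    rw [← Real.Gamma_add_one (by positivity)]
    congr 1
    field_simp
    ring
  have g3 : (1 / q + 3 / 2 : ℝ) = 1 / 2 + (q + 1) / q := by
    field_simp
    ring
  rw [g1, g2, g3]
  ring

end GenSinDeriv

/-! ## The sharp first order inequality -/

section FirstOrder

variable {q : ℝ}

/-- Take logarithms and apply `log x ≤ x - 1` to both factors, strictly to `m`: the linear bounds
cancel. It is used with `a = q/2` and `m` the ratio of `∫ |f|^q` to `∫ sin^q`. -/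
lemma rpow_mul_lt_one_of_ne_one {a m : ℝ} (ha : 0 < a) (hm : 0 < m) (hma : m < a + 1)
    (hne : m ≠ 1) : m ^ (1 / a) * ((a + 1 - m) / a) < 1 := by
  have h1 : 0 < (a + 1 - m) / a := div_pos (by linarith) ha
  rw [Real.rpow_def_of_pos hm, ← Real.exp_log h1, ← Real.exp_add, Real.exp_lt_one_iff]
  have e1 := Real.log_lt_sub_one_of_pos hm hne
  have e2 := Real.log_le_sub_one_of_pos h1
  have e3 : Real.log m * (1 / a) < (m - 1) * (1 / a) := by gcongr
  have e4 : (m - 1) * (1 / a) + ((a + 1 - m) / a - 1) = 0 := by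
    field_simp
    ring
  linarith

lemma intervalIntegral_sq_eq_zero {a b : ℝ} (hab : a < b) {f : ℝ → ℝ} (hf : Continuous f)
    (h : ∫ x in a..b, f x ^ 2 ≤ 0) {x : ℝ} (hx : x ∈ Set.Icc a b) : f x = 0 := by
  by_contra hne
  refine absurd h (not_le.2 ?_)
  exact intervalIntegral.integral_pos hab (hf.pow 2).continuousOn (fun y _ => sq_nonneg _)
    ⟨x, hx, by positivity⟩

/-- The calibration identity behind the sharp first order inequality. -/
lemma integral_sq_add_integral_sq (hq : 1 < q) {T x₀ k : ℝ} {f f' : ℝ → ℝ} (hf' : Continuous f')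
    (hf : ∀ x, HasDerivAt f (f' x) x) (h0 : f 0 = 0) (hT : f T = 0) (hT0 : 0 ≤ T)
    (hle : ∀ x ∈ Set.Icc 0 T, |f x| ≤ 1) (hx1 : f x₀ = 1) :
    (∫ x in (0 : ℝ)..x₀, (f' x - k * genSinSpeed q (f x)) ^ 2) +
        ∫ x in x₀..T, (f' x + k * genSinSpeed q (f x)) ^ 2 =
      (∫ x in (0 : ℝ)..T, f' x ^ 2) + k ^ 2 * (T - ∫ x in (0 : ℝ)..T, |f x| ^ q) -
        4 * k * ∫ t in (0 : ℝ)..1, genSinSpeed q t := by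
  have hfc : Continuous f := continuous_iff_continuousAt.2 fun x => (hf x).continuousAt
  have hhc : Continuous fun x => genSinSpeed q (f x) := (continuous_genSinSpeed hq).comp hfc
  set A : ℝ → ℝ := fun x => f' x ^ 2 + k ^ 2 * genSinSpeed q (f x) ^ 2 with hA
  set B : ℝ → ℝ := fun x => genSinSpeed q (f x) * f' x with hB
  have hAc : Continuous A := by fun_prop
  have hBc : Continuous B := by fun_prop
  -- The cross term is an exact derivative, so its integral depends only on the values of `f` at the
  -- endpoints.
  have hBint : ∀ a b, ∫ x in a..b, B x =
      (∫ t in (0 : ℝ)..f b, genSinSpeed q t) - ∫ t in (0 : ℝ)..f a, genSinSpeed q t := by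
    intro a b
    exact intervalIntegral.integral_eq_sub_of_hasDerivAt
      (f := fun x => ∫ t in (0 : ℝ)..f x, genSinSpeed q t)
      (fun x _ => (hasDerivAt_integral_genSinSpeed hq (f x)).comp x (hf x))
      (hBc.intervalIntegrable _ _)
  have e1 : ∫ x in (0 : ℝ)..x₀, (f' x - k * genSinSpeed q (f x)) ^ 2 =
      (∫ x in (0 : ℝ)..x₀, A x) - 2 * k * ∫ t in (0 : ℝ)..1, genSinSpeed q t := by
    have := hBint 0 x₀
    rw [h0, hx1, intervalIntegral.integral_same, sub_zero] at this
    rw [← this, ← intervalIntegral.integral_const_mul, ← intervalIntegral.integral_sub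
      (hAc.intervalIntegrable _ _) ((hBc.const_mul _).intervalIntegrable _ _)]
    congr 1
    ext x
    simp only [hA, hB]
    ring
  have e2 : ∫ x in x₀..T, (f' x + k * genSinSpeed q (f x)) ^ 2 =
      (∫ x in x₀..T, A x) - 2 * k * ∫ t in (0 : ℝ)..1, genSinSpeed q t := by
    have := hBint x₀ T
    rw [hT, hx1, intervalIntegral.integral_same, zero_sub] at this
    rw [sub_eq_add_neg, ← mul_neg, ← this, ← intervalIntegral.integral_const_mul,
      ← intervalIntegral.integral_add
        (hAc.intervalIntegrable _ _) ((hBc.const_mul _).intervalIntegrable _ _)]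
    congr 1
    ext x
    simp only [hA, hB]
    ring
  have e3 : ∫ x in (0 : ℝ)..T, genSinSpeed q (f x) ^ 2 = T - ∫ x in (0 : ℝ)..T, |f x| ^ q := by
    have hcq : Continuous fun x => |f x| ^ q :=
      hfc.abs.rpow_const fun _ => Or.inr (by linarith)
    have : ∫ x in (0 : ℝ)..T, genSinSpeed q (f x) ^ 2 = ∫ x in (0 : ℝ)..T, (1 - |f x| ^ q) := by
      apply intervalIntegral.integral_congr
      intro x hx
      rw [Set.uIcc_of_le hT0] at hx
      exact genSinSpeed_sq hq (hle x hx)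
    rw [this, intervalIntegral.integral_sub (by simp) (hcq.intervalIntegrable _ _)]
    simp
  have e4 : ∫ x in (0 : ℝ)..T, A x =
      (∫ x in (0 : ℝ)..T, f' x ^ 2) + k ^ 2 * (T - ∫ x in (0 : ℝ)..T, |f x| ^ q) := by
    rw [← e3, ← intervalIntegral.integral_const_mul]
    apply intervalIntegral.integral_add <;>
      exact Continuous.intervalIntegrable (by fun_prop) _ _
  have e5 := intervalIntegral.integral_add_adjacent_intervals (hAc.intervalIntegrable (μ := volume) 0 x₀)
    (hAc.intervalIntegrable x₀ T)
  rw [e1, e2, ← e4, ← e5]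
  ring

/-- A solution of `f' = √(1 - |f|^q)`, `f(0) = 0`, that reaches the value `1` is `sin_{2,q}` on
`[0, π_{2,q}/2]`. -/
lemma eqOn_genSin_of_deriv_eq (hq : 1 < q) {x₀ : ℝ} (hx₀ : 0 ≤ x₀) {f : ℝ → ℝ}
    (hfc : Continuous f)
    (hf : ∀ x ∈ Set.Icc 0 x₀, HasDerivAt f (genSinSpeed q (f x)) x) (h0 : f 0 = 0)
    (hle : ∀ x ∈ Set.Icc 0 x₀, f x ≤ 1) (hx1 : f x₀ = 1) :
    genPi 2 q / 2 ≤ x₀ ∧ Set.EqOn f (genSin 2 q) (Set.Icc 0 (genPi 2 q / 2)) := by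
  -- The equation loses uniqueness at the value `1`, where a solution may rest. Everything is
  -- therefore done up to the first point `x₁` with value `1`, which may lie before `x₀`.
  have hKc : IsCompact (Set.Icc 0 x₀ ∩ f ⁻¹' {1}) :=
    isCompact_Icc.inter_right (isClosed_singleton.preimage hfc)
  obtain ⟨x₁, ⟨hx₁, hfx₁⟩, hleast⟩ := hKc.exists_isLeast ⟨x₀, ⟨hx₀, le_rfl⟩, hx1⟩
  have hmono : MonotoneOn f (Set.Icc 0 x₀) := by
    apply monotoneOn_of_deriv_nonneg (convex_Icc _ _) hfc.continuousOn
    · exact fun x hx => (hf x (interior_subset hx)).differentiableAt.differentiableWithinAt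
    · intro x hx
      rw [(hf x (interior_subset hx)).deriv]
      exact genSinSpeed_nonneg _ _
  have hnn : ∀ x ∈ Set.Icc 0 x₀, 0 ≤ f x := fun x hx => by
    rw [← h0]
    exact hmono ⟨le_rfl, hx₀⟩ hx hx.1
  have hlt : ∀ x ∈ Set.Ico 0 x₁, f x < 1 := fun x hx => by
    have hx' : x ∈ Set.Icc 0 x₀ := ⟨hx.1, hx.2.le.trans hx₁.2⟩
    refine (hle x hx').lt_of_ne fun h => ?_
    exact absurd (hleast ⟨hx', h⟩) (not_le.2 hx.2)
  have hpos : ∀ x ∈ Set.Ico 0 x₁, 0 < genSinSpeed q (f x) := fun x hx =>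
    genSinSpeed_pos hq (by
      rw [abs_of_nonneg (hnn x ⟨hx.1, hx.2.le.trans hx₁.2⟩)]
      exact hlt x hx)
  have hstrict : StrictMonoOn f (Set.Icc 0 x₁) := by
    apply strictMonoOn_of_deriv_pos (convex_Icc _ _) hfc.continuousOn
    intro x hx
    rw [interior_Icc] at hx
    rw [(hf x ⟨hx.1.le, hx.2.le.trans hx₁.2⟩).deriv]
    exact hpos x ⟨hx.1.le, hx.2⟩
  -- Separation of variables: the composite has derivative `1` and starts at `0`. At `x₁` it gives
  -- `x₁ = π/2`.
  have key : ∀ x ∈ Set.Icc 0 x₁, genArcsin 2 q (f x) = x := by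
    intro x hx
    have h := intervalIntegral.integral_eq_sub_of_hasDerivAt_of_le
      (f := fun x => genArcsin 2 q (f x)) (f' := fun _ => 1) (a := 0) (b := x) hx.1
      ((continuousOn_genArcsin hq).comp hfc.continuousOn fun y hy =>
        have hy' : y ∈ Set.Icc 0 x₀ := ⟨hy.1, (hy.2.trans hx.2).trans hx₁.2⟩
        ⟨hnn y hy', hle y hy'⟩)
      (fun y hy => by
        have hyx : y < x₁ := hy.2.trans_le hx.2
        have hy0 : 0 < f y := by
          have := hstrict ⟨le_rfl, hx₁.1⟩ ⟨hy.1.le, hyx.le⟩ hy.1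
          rwa [h0] at this
        have := (hasDerivAt_genArcsin hq ⟨hy0, hlt y ⟨hy.1.le, hyx⟩⟩).comp y
          (hf y ⟨hy.1.le, hyx.le.trans hx₁.2⟩)
        rwa [inv_mul_cancel₀ (hpos y ⟨hy.1.le, hyx⟩).ne'] at this) (by simp)
    simp only [h0, genArcsin_zero, intervalIntegral.integral_const, sub_zero, smul_eq_mul,
      mul_one] at h
    exact h.symm
  have hx₁T : x₁ = genPi 2 q / 2 := by
    rw [← key x₁ ⟨hx₁.1, le_rfl⟩, show f x₁ = 1 from hfx₁, genArcsin_one]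
  refine ⟨hx₁T ▸ hx₁.2, fun x hx => ?_⟩
  have hx' : x ∈ Set.Icc 0 x₁ := by rwa [hx₁T]
  have hx'' : x ∈ Set.Icc 0 x₀ := ⟨hx.1, hx'.2.trans hx₁.2⟩
  exact (genSin_eq_of_genArcsin_eq hq hx ⟨hnn x hx'', hle x hx''⟩ (key x hx')).symm

/-- The best constant in `‖f‖_q² ≤ C ‖f'‖_2²`. -/
noncomputable def firstOrderConst (q : ℝ) : ℝ :=
  (∫ x in (0 : ℝ)..genPi 2 q, genSin 2 q x ^ q) ^ (2 / q) /
    (q / 2 * ∫ x in (0 : ℝ)..genPi 2 q, genSin 2 q x ^ q)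

/-- Read off from `(q/2)∫ sin^q = 2∫₀¹ √(1 - t^q)`, whose right side is visibly positive. -/
lemma integral_genSin_rpow_pos (hq : 1 < q) :
    0 < ∫ x in (0 : ℝ)..genPi 2 q, genSin 2 q x ^ q := by
  have h1 := integral_genSinDeriv_sq hq
  rw [integral_genSinDeriv_sq_eq_two_mul hq] at h1
  have h2 := integral_genSinSpeed_pos hq
  have h3 : 0 < q / 2 * ∫ x in (0 : ℝ)..genPi 2 q, genSin 2 q x ^ q := by linarith
  exact pos_of_mul_pos_right h3 (by linarith)

lemma firstOrderConst_pos (hq : 1 < q) : 0 < firstOrderConst q := by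
  have := integral_genSin_rpow_pos hq
  unfold firstOrderConst
  positivity

/-- The sharp first order inequality for functions with maximal value `1`. -/
lemma first_order_normalized (hq : 1 < q) {x₀ : ℝ} {f f' : ℝ → ℝ} (hf' : Continuous f')
    (hf : ∀ x, HasDerivAt f (f' x) x) (h0 : f 0 = 0) (hT : f (genPi 2 q) = 0)
    (hle : ∀ x ∈ Set.Icc 0 (genPi 2 q), |f x| ≤ 1) (hx₀ : x₀ ∈ Set.Icc 0 (genPi 2 q))
    (hx1 : f x₀ = 1) :
    (∫ x in (0 : ℝ)..genPi 2 q, |f x| ^ q) ^ (2 / q) ≤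
        firstOrderConst q * ∫ x in (0 : ℝ)..genPi 2 q, f' x ^ 2 ∧
      ((∫ x in (0 : ℝ)..genPi 2 q, |f x| ^ q) ^ (2 / q) =
        (firstOrderConst q * ∫ x in (0 : ℝ)..genPi 2 q, f' x ^ 2) →
        Set.EqOn f (genSin 2 q) (Set.Icc 0 (genPi 2 q))) := by
  have hTpos := genPi_pos hq
  have hfc : Continuous f := continuous_iff_continuousAt.2 fun x => (hf x).continuousAt
  have hcq : Continuous fun x => |f x| ^ q := hfc.abs.rpow_const fun _ => Or.inr (by linarith)
  have hhc : Continuous fun x => genSinSpeed q (f x) := (continuous_genSinSpeed hq).comp hfc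
  have hxpos : 0 < x₀ := hx₀.1.lt_of_ne fun h => by simp [← h, h0] at hx1
  have hxlt : x₀ < genPi 2 q := hx₀.2.lt_of_ne fun h => by simp [h, hT] at hx1
  have cal := fun k => integral_sq_add_integral_sq hq (k := k) hf' hf h0 hT hTpos.le hle hx1
  have sqnn : ∀ k : ℝ, 0 ≤ (∫ x in (0 : ℝ)..x₀, (f' x - k * genSinSpeed q (f x)) ^ 2) ∧
      0 ≤ ∫ x in x₀..genPi 2 q, (f' x + k * genSinSpeed q (f x)) ^ 2 := fun k =>
    ⟨intervalIntegral.integral_nonneg hx₀.1 fun _ _ => sq_nonneg _,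
      intervalIntegral.integral_nonneg hx₀.2 fun _ _ => sq_nonneg _⟩
  have r1 := integral_genSinDeriv_sq hq
  have r2 := integral_genSinDeriv_sq' hq
  have r3 := integral_genSinDeriv_sq_eq_two_mul hq
  have hn := integral_genSin_rpow_pos hq
  have hN : 0 < ∫ x in (0 : ℝ)..genPi 2 q, |f x| ^ q :=
    intervalIntegral.integral_pos hTpos hcq.continuousOn (fun _ _ => by positivity)
      ⟨x₀, hx₀, by simp [hx1]⟩
  have hNT : 0 < genPi 2 q - ∫ x in (0 : ℝ)..genPi 2 q, |f x| ^ q := by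
    have : 0 < ∫ x in (0 : ℝ)..genPi 2 q, (1 - |f x| ^ q) := by
      apply intervalIntegral.integral_pos hTpos (continuous_const.sub hcq).continuousOn
      · intro x hx
        rw [Pi.sub_apply, sub_nonneg]
        exact Real.rpow_le_one (abs_nonneg (f x)) (hle x (Set.Ioc_subset_Icc_self hx))
          (by linarith : 0 ≤ q)
      · refine ⟨0, by simp [hTpos.le], ?_⟩
        simp [h0, Real.zero_rpow (by linarith : q ≠ 0)]
    rw [intervalIntegral.integral_sub (by simp) (hcq.intervalIntegrable _ _)] at this
    simpa using this
  set T := genPi 2 q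
  set D := ∫ t in (0 : ℝ)..1, genSinSpeed q t
  set N := ∫ x in (0 : ℝ)..T, |f x| ^ q
  set I := ∫ x in (0 : ℝ)..T, f' x ^ 2
  have hKdef : firstOrderConst q = (∫ x in (0 : ℝ)..T, genSin 2 q x ^ q) ^ (2 / q) /
    (q / 2 * ∫ x in (0 : ℝ)..T, genSin 2 q x ^ q) := rfl
  set n := ∫ x in (0 : ℝ)..T, genSin 2 q x ^ q
  set K := firstOrderConst q
  have hD : 2 * D = q / 2 * n := by rw [← r3, r1]
  have hTn : T - n = q / 2 * n := by rw [← r2, r1]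
  set E := q / 2 * n with hE
  have hEpos : 0 < E := by positivity
  -- `k = E/(T - N)` minimises the quadratic `I + k²(T - N) - 4kD`, since `2D = E`.
  have hI : E ^ 2 ≤ I * (T - N) := by
    have h1 := cal (E / (T - N))
    obtain ⟨h2, h3⟩ := sqnn (E / (T - N))
    have h4 : 0 ≤ I + (E / (T - N)) ^ 2 * (T - N) - 4 * (E / (T - N)) * D := by linarith
    have h5 : I + (E / (T - N)) ^ 2 * (T - N) - 4 * (E / (T - N)) * D = I - E ^ 2 / (T - N) := by
      have : D = E / 2 := by linarith
      rw [this]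
      field_simp
      ring
    rw [h5, sub_nonneg, div_le_iff₀ hNT] at h4
    exact h4
  -- `T = (q/2 + 1) n`, so this is `N < T` rescaled.
  have hmlt : N / n < q / 2 + 1 := by
    rw [div_lt_iff₀ hn]
    have : (q / 2 + 1) * n = T := by rw [add_mul, one_mul, ← hE]; linarith
    linarith
  have hexp : 1 / (q / 2) = 2 / q := by rw [one_div_div]
  have hfrac : (q / 2 + 1 - N / n) / (q / 2) = (T - N) / E := by
    have : T = E + n := by linarith
    rw [this, hE]
    field_simp
  have hlog : N ≠ n → (N / n) ^ (2 / q) * ((T - N) / E) < 1 := by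
    intro hne
    have := rpow_mul_lt_one_of_ne_one (a := q / 2) (m := N / n) (by linarith) (div_pos hN hn) hmlt
      (fun h => hne (by rwa [div_eq_one_iff_eq hn.ne'] at h))
    rwa [hexp, hfrac] at this
  have hlog' : (N / n) ^ (2 / q) * ((T - N) / E) ≤ 1 := by
    obtain h | h := eq_or_ne N n
    · rw [h, div_self hn.ne', Real.one_rpow, hTn, div_self hEpos.ne', one_mul]
    · exact (hlog h).le
  have hsplit : N ^ (2 / q) = (N / n) ^ (2 / q) * n ^ (2 / q) := by
    rw [Real.div_rpow hN.le hn.le, div_mul_cancel₀ _ (Real.rpow_pos_of_pos hn _).ne']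
  have hnq : 0 < n ^ (2 / q) := Real.rpow_pos_of_pos hn _
  have hIpos : 0 < I := pos_of_mul_pos_left (lt_of_lt_of_le (by positivity) hI) hNT.le
  have hratio : (N / n) ^ (2 / q) * E ≤ (N / n) ^ (2 / q) * ((T - N) / E) * I := by
    have hm : 0 ≤ (N / n) ^ (2 / q) := Real.rpow_nonneg (div_pos hN hn).le _
    rw [mul_assoc]
    apply mul_le_mul_of_nonneg_left _ hm
    rw [div_mul_eq_mul_div, le_div_iff₀ hEpos]
    nlinarith
  have hKI : K * I = n ^ (2 / q) * (I / E) := by rw [hKdef]; ring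
  refine ⟨?_, fun heq => ?_⟩
  · rw [hsplit, hKI, mul_comm]
    apply mul_le_mul_of_nonneg_left _ hnq.le
    rw [le_div_iff₀ hEpos]
    exact hratio.trans (mul_le_of_le_one_left hIpos.le hlog')
  · rw [hsplit, hKI, mul_comm] at heq
    have heq' := mul_left_cancel₀ hnq.ne' heq
    rw [eq_div_iff hEpos.ne'] at heq'
    have hNn : N = n := by
      by_contra hne
      have := mul_lt_of_lt_one_left hIpos (hlog hne)
      linarith
    have hIE : I = E := by
      rw [hNn, div_self hn.ne', Real.one_rpow, one_mul] at heq'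
      exact heq'.symm
    -- For `N = n` and `I = E` the optimal `k` is `E/(T - n) = 1`. The sum of the two integrals of
    -- squares is then zero, so both integrands vanish.
    have h1 := cal 1
    obtain ⟨h2, h3⟩ := sqnn 1
    have h4 : I + 1 ^ 2 * (T - N) - 4 * 1 * D = 0 := by
      rw [hNn, hIE, hTn]
      linarith
    rw [h4] at h1
    have z1 : ∀ x ∈ Set.Icc 0 x₀, f' x = genSinSpeed q (f x) := fun x hx => by
      have := intervalIntegral_sq_eq_zero hxpos
        (f := fun x => f' x - 1 * genSinSpeed q (f x)) (by fun_prop) (by linarith) hx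
      linarith
    have z2 : ∀ x ∈ Set.Icc x₀ T, f' x = -genSinSpeed q (f x) := fun x hx => by
      have := intervalIntegral_sq_eq_zero hxlt
        (f := fun x => f' x + 1 * genSinSpeed q (f x)) (by fun_prop) (by linarith) hx
      linarith
    obtain ⟨-, s1⟩ := eqOn_genSin_of_deriv_eq hq hxpos.le hfc (fun x hx => z1 x hx ▸ hf x) h0
      (fun x hx => (le_abs_self _).trans (hle x ⟨hx.1, hx.2.trans hx₀.2⟩)) hx1
    -- To the right of `x₀`, the reflected function solves the same equation.
    obtain ⟨-, s2⟩ := eqOn_genSin_of_deriv_eq hq (x₀ := T - x₀) (f := fun x => f (T - x))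
      (by linarith) (by fun_prop)
      (fun x hx => by
        have e := z2 (T - x) ⟨by linarith [hx.2], by linarith [hx.1]⟩
        have := (hf (T - x)).comp_const_sub T x
        rwa [e, neg_neg] at this) (by simpa using hT)
      (fun x hx => (le_abs_self _).trans
        (hle (T - x) ⟨by linarith [hx.2], by linarith [hx.1]⟩)) (by simpa using hx1)
    intro x hx
    obtain h | h := le_total x (T / 2)
    · exact s1 ⟨hx.1, h⟩
    · have := s2 (x := T - x) ⟨by linarith [hx.2], by linarith⟩
      simp only [sub_sub_cancel] at this
      rw [this, genSin_symm hq hx]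

/-- The sharp first order inequality with its equality case. -/
lemma first_order (hq : 1 < q) {f f' : ℝ → ℝ} (hf' : Continuous f')
    (hf : ∀ x, HasDerivAt f (f' x) x) (h0 : f 0 = 0) (hT : f (genPi 2 q) = 0) :
    (∫ x in (0 : ℝ)..genPi 2 q, |f x| ^ q) ^ (2 / q) ≤
        firstOrderConst q * ∫ x in (0 : ℝ)..genPi 2 q, f' x ^ 2 ∧
      ((∫ x in (0 : ℝ)..genPi 2 q, |f x| ^ q) ^ (2 / q) =
        (firstOrderConst q * ∫ x in (0 : ℝ)..genPi 2 q, f' x ^ 2) →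
        ∃ c : ℝ, ∀ x ∈ Set.Icc 0 (genPi 2 q), f x = c * genSin 2 q x) := by
  have hTpos := genPi_pos hq
  have hfc : Continuous f := continuous_iff_continuousAt.2 fun x => (hf x).continuousAt
  obtain ⟨x₀, hx₀, hmax⟩ := isCompact_Icc.exists_isMaxOn (s := Set.Icc 0 (genPi 2 q))
    ⟨0, le_rfl, hTpos.le⟩ hfc.abs.continuousOn
  obtain hM | hM := eq_or_ne (f x₀) 0
  · have hz : ∀ x ∈ Set.Icc 0 (genPi 2 q), f x = 0 := fun x hx => by
      have := hmax hx
      simpa [hM] using this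
    refine ⟨?_, fun _ => ⟨0, fun x hx => by rw [hz x hx, zero_mul]⟩⟩
    have : ∫ x in (0 : ℝ)..genPi 2 q, |f x| ^ q = 0 := by
      rw [intervalIntegral.integral_congr (g := fun _ => 0)]
      · simp
      · intro x hx
        rw [Set.uIcc_of_le hTpos.le] at hx
        simp [hz x hx, Real.zero_rpow (by linarith : q ≠ 0)]
    rw [this, Real.zero_rpow (by positivity)]
    exact mul_nonneg (firstOrderConst_pos hq).le
      (intervalIntegral.integral_nonneg hTpos.le fun _ _ => sq_nonneg _)
  -- The scaling uses the signed value at a maximum of `|f|`, so the normalised function equals `+1`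
  -- there whatever the sign of `f`.
  set M := f x₀ with hMdef
  have key := first_order_normalized hq (x₀ := x₀) (f := fun x => M⁻¹ * f x)
    (f' := fun x => M⁻¹ * f' x) (by fun_prop) (fun x => (hf x).const_mul _) (by simp [h0])
    (by simp [hT]) (fun x hx => by
      have : |f x| ≤ |M| := hmax hx
      rw [abs_mul, abs_inv, inv_mul_le_iff₀ (abs_pos.2 hM), mul_one]
      exact this) hx₀ (inv_mul_cancel₀ hM)
  have hMq : 0 < M⁻¹ ^ 2 := by positivity
  have e1 : (∫ x in (0 : ℝ)..genPi 2 q, |M⁻¹ * f x| ^ q) ^ (2 / q) =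
      M⁻¹ ^ 2 * (∫ x in (0 : ℝ)..genPi 2 q, |f x| ^ q) ^ (2 / q) := by
    simp only [abs_mul, Real.mul_rpow (abs_nonneg _) (abs_nonneg _)]
    rw [intervalIntegral.integral_const_mul, Real.mul_rpow (by positivity)
      (intervalIntegral.integral_nonneg hTpos.le fun _ _ => by positivity),
      ← Real.rpow_mul (abs_nonneg _), mul_div_cancel₀ _ (by linarith : q ≠ 0), Real.rpow_two, sq_abs]
  have e2 : firstOrderConst q * ∫ x in (0 : ℝ)..genPi 2 q, (M⁻¹ * f' x) ^ 2 =
      M⁻¹ ^ 2 * (firstOrderConst q * ∫ x in (0 : ℝ)..genPi 2 q, f' x ^ 2) := by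
    simp only [mul_pow]
    rw [intervalIntegral.integral_const_mul]
    ring
  rw [e1, e2] at key
  refine ⟨le_of_mul_le_mul_left key.1 hMq, fun heq => ⟨M, fun x hx => ?_⟩⟩
  rw [← key.2 (by rw [heq]) hx, mul_inv_cancel_left₀ hM]

end FirstOrder

/-! ## The sharp second order inequality -/

section SecondOrder

lemma LpInt.norm_eq {r T : ℝ} (hr : 0 < r) (u : LpInt r T) :
    ‖u‖ = (∫ x in Set.Icc 0 T, |u x| ^ r) ^ (1 / r) := by
  rw [Lp.norm_def, MemLp.eLpNorm_eq_integral_rpow_norm (by simpa using hr) ENNReal.ofReal_ne_top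
    (Lp.memLp u), ENNReal.toReal_ofReal (by positivity), ENNReal.toReal_ofReal hr.le, one_div]
  rfl

lemma LpInt.norm_eq_of_ae_eq {r T : ℝ} (hr : 0 < r) {u : LpInt r T} {f : ℝ → ℝ}
    (h : u =ᵐ[intervalMeasure T] f) :
    ‖u‖ = (∫ x in Set.Icc 0 T, |f x| ^ r) ^ (1 / r) := by
  rw [LpInt.norm_eq hr]
  congr 1
  apply integral_congr_ae
  filter_upwards [h] with x hx
  rw [hx]

lemma memLp_of_continuousOn_Icc {T : ℝ} {f : ℝ → ℝ} (hf : ContinuousOn f (Set.Icc 0 T))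
    (r : ℝ≥0∞) : MemLp f r (intervalMeasure T) := by
  obtain ⟨C, hC⟩ := isCompact_Icc.exists_bound_of_continuousOn hf
  refine MemLp.of_bound (hf.aestronglyMeasurable measurableSet_Icc) C ?_
  exact (ae_restrict_iff' measurableSet_Icc).2 (Filter.Eventually.of_forall hC)

namespace SobolevD

variable {p q T : ℝ} [Fact (1 < p)] [Fact (1 < q)]

lemma embedding_ae_eq (u : SobolevD p T) :
    embedding p q T u =ᵐ[intervalMeasure T] toLp u :=
  (memLp q u).coeFn_toLp

/-- An element of `W^{2,p}_D` is built from continuous functions. -/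
lemma exists_of_continuousOn {f f' f'' : ℝ → ℝ} (hf : ContinuousOn f (Set.Icc 0 T))
    (hf' : ContinuousOn f' (Set.Icc 0 T)) (hf'' : ContinuousOn f'' (Set.Icc 0 T))
    (h1 : IsWeakDeriv T f f') (h2 : IsWeakDeriv T f' f'') (h0 : f 0 = 0) (hT : f T = 0) :
    ∃ u : SobolevD p T, toLp u =ᵐ[intervalMeasure T] f ∧
      secondDeriv u =ᵐ[intervalMeasure T] f'' := by
  have m0 := memLp_of_continuousOn_Icc hf (ENNReal.ofReal p)
  have m1 := memLp_of_continuousOn_Icc hf' (ENNReal.ofReal p)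
  have m2 := memLp_of_continuousOn_Icc hf'' (ENNReal.ofReal p)
  have w1 : IsWeakDeriv T (m0.toLp f) (m1.toLp f') :=
    h1.congr m0.coeFn_toLp.symm m1.coeFn_toLp.symm
  have w2 : IsWeakDeriv T (m1.toLp f') (m2.toLp f'') :=
    h2.congr m1.coeFn_toLp.symm m2.coeFn_toLp.symm
  let u : SobolevD p T := (⟨m0.toLp f, ⟨m1.toLp f', m2.toLp f'', w1, w2⟩,
    ⟨f, m0.coeFn_toLp, hf, h0, hT⟩⟩ : sobolevDSubmodule p T)
  obtain ⟨v, h3, h4⟩ := secondDeriv_spec u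
  refine ⟨u, m0.coeFn_toLp, ?_⟩
  rw [weakDerivs_unique (u := m0.toLp f) h3 h4 w1 w2]
  exact m2.coeFn_toLp

/-- The sharp inequality `‖u‖_q ≤ C ‖u''‖_p`, whose equality case is `u = c sin_{2,q}`. -/
lemma norm_embedding_le (hpq : p.HolderConjugate q) (u : SobolevD p (genPi 2 q)) :
    ‖embedding p q (genPi 2 q) u‖ ≤ firstOrderConst q * ‖secondDeriv u‖ ∧
      (‖embedding p q (genPi 2 q) u‖ = firstOrderConst q * ‖secondDeriv u‖ →
        ∃ c : ℝ, toLp u =ᵐ[intervalMeasure (genPi 2 q)] fun x => c * genSin 2 q x) := by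
  have hq : 1 < q := Fact.out
  have hT := genPi_pos hq
  obtain ⟨f, f', hf'c, hf, huf, f0, fT, hint⟩ := exists_contDiff_representative hT u
  have hfc : Continuous f := continuous_iff_continuousAt.2 fun x => (hf x).continuousAt
  obtain ⟨hle, heq⟩ := first_order hq hf'c hf f0 fT
  have hX := LpInt.norm_eq_of_ae_eq hpq.symm.pos ((embedding_ae_eq (q := q) u).trans huf)
  have hY := LpInt.norm_eq hpq.pos (secondDeriv u)
  -- Hölder applied to `∫ f'² = -∫ f u''`.
  have hXY : ∫ x in (0 : ℝ)..genPi 2 q, f' x ^ 2 ≤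
      ‖embedding p q (genPi 2 q) u‖ * ‖secondDeriv u‖ := by
    rw [hint, hX, hY, mul_comm]
    refine le_trans ?_ (integral_mul_norm_le_Lp_mul_Lq hpq (Lp.memLp (secondDeriv u))
      (memLp_of_continuousOn_Icc hfc.continuousOn _))
    rw [← integral_neg]
    refine (le_abs_self _).trans ((abs_integral_le_integral_abs).trans_eq ?_)
    congr 1
    ext x
    rw [abs_neg, abs_mul, Real.norm_eq_abs, Real.norm_eq_abs, mul_comm]
  have hN0 : 0 ≤ ∫ x in (0 : ℝ)..genPi 2 q, |f x| ^ q :=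
    intervalIntegral.integral_nonneg hT.le fun _ _ => by positivity
  have hX2 : ‖embedding p q (genPi 2 q) u‖ ^ 2 =
      (∫ x in (0 : ℝ)..genPi 2 q, |f x| ^ q) ^ (2 / q) := by
    rw [hX, setIntegral_Icc_eq_intervalIntegral hT.le, ← Real.rpow_natCast, ← Real.rpow_mul hN0]
    congr 1
    push_cast
    ring
  rw [← hX2] at hle heq
  have hK := firstOrderConst_pos hq
  set X := ‖embedding p q (genPi 2 q) u‖
  set Y := ‖secondDeriv u‖
  set I := ∫ x in (0 : ℝ)..genPi 2 q, f' x ^ 2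
  have hKXY : firstOrderConst q * I ≤ firstOrderConst q * (X * Y) :=
    mul_le_mul_of_nonneg_left hXY hK.le
  refine ⟨?_, fun h => ?_⟩
  · have hX0 : 0 ≤ X := norm_nonneg _
    obtain h | h := hX0.eq_or_lt
    · rw [← h]
      exact mul_nonneg hK.le (norm_nonneg _)
    · apply le_of_mul_le_mul_left _ h
      calc X * X = X ^ 2 := by ring
        _ ≤ firstOrderConst q * (X * Y) := hle.trans hKXY
        _ = _ := by ring
  -- If `X = KY` then `K(XY) = X²`, so the chain `X² ≤ KI ≤ K(XY)` collapses. The equality case of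
  -- Hölder is not needed.
  · obtain ⟨c, hc⟩ := heq (le_antisymm hle (hKXY.trans_eq (by
      rw [mul_left_comm, ← h, sq])))
    refine ⟨c, huf.trans ?_⟩
    exact (ae_restrict_iff' measurableSet_Icc).2 (Filter.Eventually.of_forall hc)

variable (p) in
/-- `sin_{2,q}` as an element of `W^{2,p}_D` attains the best constant. -/
lemma exists_extremal (hpq : p.HolderConjugate q) :
    ∃ u : SobolevD p (genPi 2 q),
      toLp u =ᵐ[intervalMeasure (genPi 2 q)] genSin 2 q ∧ ‖secondDeriv u‖ ≠ 0 ∧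
        ‖embedding p q (genPi 2 q) u‖ = firstOrderConst q * ‖secondDeriv u‖ := by
  have hq : 1 < q := Fact.out
  have hT := genPi_pos hq
  obtain ⟨u, hu, hu'⟩ := exists_of_continuousOn (p := p) (continuousOn_genSin hq)
    (continuousOn_genSinDeriv hq) (continuousOn_genSinDeriv₂ hq) (isWeakDeriv_genSin hq)
    (isWeakDeriv_genSinDeriv hq) (genSin_zero hq) (genSin_genPi hq)
  have hn := integral_genSin_rpow_pos hq
  have hX := LpInt.norm_eq_of_ae_eq hpq.symm.pos ((embedding_ae_eq (q := q) u).trans hu)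
  have hY := LpInt.norm_eq_of_ae_eq hpq.pos hu'
  have e1 : ∫ x in Set.Icc 0 (genPi 2 q), |genSin 2 q x| ^ q =
      ∫ x in (0 : ℝ)..genPi 2 q, genSin 2 q x ^ q := by
    rw [← setIntegral_Icc_eq_intervalIntegral hT.le]
    apply setIntegral_congr_fun measurableSet_Icc
    intro x hx
    simp only [abs_of_nonneg (genSin_mem_Icc hq hx).1]
  -- Conjugacy gives `(q - 1)p = q`, so both norms of the sine are expressed by `∫ sin^q`.
  have e2 : ∫ x in Set.Icc 0 (genPi 2 q), |genSinDeriv₂ q x| ^ p =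
      (q / 2) ^ p * ∫ x in (0 : ℝ)..genPi 2 q, genSin 2 q x ^ q := by
    rw [← setIntegral_Icc_eq_intervalIntegral hT.le, ← integral_const_mul]
    apply setIntegral_congr_fun measurableSet_Icc
    intro x hx
    have hs := (genSin_mem_Icc hq hx).1
    simp only [genSinDeriv₂]
    rw [abs_mul, abs_neg, abs_of_pos (by linarith : 0 < q / 2),
      abs_of_nonneg (Real.rpow_nonneg hs _), Real.mul_rpow (by linarith) (Real.rpow_nonneg hs _),
      ← Real.rpow_mul hs, hpq.symm.sub_one_mul_conj]
  rw [e1] at hX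
  rw [e2] at hY
  have hfc : firstOrderConst q = (∫ x in (0 : ℝ)..genPi 2 q, genSin 2 q x ^ q) ^ (2 / q) /
    (q / 2 * ∫ x in (0 : ℝ)..genPi 2 q, genSin 2 q x ^ q) := rfl
  set n := ∫ x in (0 : ℝ)..genPi 2 q, genSin 2 q x ^ q
  rw [Real.mul_rpow (by positivity) hn.le, ← Real.rpow_mul (by positivity),
    mul_one_div_cancel hpq.ne_zero, Real.rpow_one] at hY
  refine ⟨u, hu, ?_, ?_⟩
  · rw [hY]
    positivity
  · have hexp : 2 / q + 1 / p = 1 / q + 1 := by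
      have := hpq.inv_add_inv_eq_one
      rw [one_div, one_div, div_eq_mul_inv]
      linarith
    have : n ^ (2 / q) * n ^ (1 / p) = n ^ (1 / q) * n := by
      rw [← Real.rpow_add hn, hexp, Real.rpow_add hn, Real.rpow_one]
    rw [hX, hY, hfc, div_mul_eq_mul_div, eq_div_iff (by positivity), mul_left_comm, ← this]
    ring

end SobolevD

/-- With `B` the Beta value, `(q/2)∫ sin^q = B`, so the constant is `(2B/q)^{2/q}/B`; conjugacy
turns the exponent `2/q - 1` into `1/q - 1/p`. -/
lemma firstOrderConst_eq {p q : ℝ} (hpq : p.HolderConjugate q) :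
    firstOrderConst q = (2 / q) ^ (2 / q) *
      ProbabilityTheory.beta (1 / 2) ((q + 1) / q) ^ (1 / q - 1 / p) := by
  have hq : 1 < q := hpq.symm.lt
  have hB : q / 2 * ∫ x in (0 : ℝ)..genPi 2 q, genSin 2 q x ^ q =
      ProbabilityTheory.beta (1 / 2) ((q + 1) / q) := by
    rw [← integral_genSinDeriv_sq hq, integral_genSinDeriv_sq_eq_two_mul hq,
      two_mul_integral_genSinSpeed hq]
  have hBpos : 0 < ProbabilityTheory.beta (1 / 2) ((q + 1) / q) :=
    ProbabilityTheory.beta_pos (by norm_num) (by positivity)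
  have hn : ∫ x in (0 : ℝ)..genPi 2 q, genSin 2 q x ^ q =
      2 / q * ProbabilityTheory.beta (1 / 2) ((q + 1) / q) := by
    rw [← hB]
    field_simp
  have hexp : 1 / q - 1 / p = 2 / q - 1 := by
    have := hpq.inv_add_inv_eq_one
    rw [one_div, one_div, div_eq_mul_inv]
    linarith
  rw [firstOrderConst, hB, hn, Real.mul_rpow (by positivity) hBpos.le, hexp,
    Real.rpow_sub_one hBpos.ne', mul_div_assoc]

end SecondOrder

/-! ### The norm and the extremal functions of the embedding -/

theorem mainTheorem5 (p p' : ℝ) [Fact (1 < p)] [Fact (1 < p')] (hpp' : p.HolderConjugate p') :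
    ∃ E₂ : SobolevD p (genPi 2 p') →L[ℝ] LpInt p' (genPi 2 p'),
      (E₂ : SobolevD p (genPi 2 p') →ₗ[ℝ] LpInt p' (genPi 2 p')) =
        SobolevD.embedding p p' (genPi 2 p') ∧
      ‖E₂‖ = (2 / p') ^ (2 / p') *
        ProbabilityTheory.beta (1 / 2) ((p' + 1) / p') ^ (1 / p' - 1 / p) ∧
      IsLUB {ρ : ℝ | ∃ f : SobolevD p (genPi 2 p'), f ≠ 0 ∧
        ρ = ‖E₂ f‖ / ‖SobolevD.secondDeriv f‖} ‖E₂‖ ∧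
      ∀ g : ℝ → ℝ,
        (∃ f : SobolevD p (genPi 2 p'), f ≠ 0 ∧
          ‖E₂ f‖ / ‖SobolevD.secondDeriv f‖ = ‖E₂‖ ∧
          SobolevD.toLp f =ᵐ[intervalMeasure (genPi 2 p')] g) ↔
        ∃ c : ℝ, c ≠ 0 ∧ g =ᵐ[intervalMeasure (genPi 2 p')] fun x => c * genSin 2 p' x := by
  have hq : 1 < p' := Fact.out
  have hbound := fun f => (SobolevD.norm_embedding_le hpp' f).1
  obtain ⟨u, hu, hu0, huE⟩ := SobolevD.exists_extremal p hpp'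
  let E₂ : SobolevD p (genPi 2 p') →L[ℝ] LpInt p' (genPi 2 p') :=
    (SobolevD.embedding p p' (genPi 2 p')).mkContinuous (firstOrderConst p') hbound
  have hE : ∀ f, E₂ f = SobolevD.embedding p p' (genPi 2 p') f := fun _ => rfl
  have hnorm : ‖E₂‖ = firstOrderConst p' := by
    apply le_antisymm (LinearMap.mkContinuous_norm_le _ (firstOrderConst_pos hq).le _)
    have := E₂.le_opNorm u
    rw [hE, huE, SobolevD.norm_def] at this
    exact le_of_mul_le_mul_right this ((norm_nonneg _).lt_of_ne' hu0)
  have hpos : ∀ f : SobolevD p (genPi 2 p'), f ≠ 0 → 0 < ‖SobolevD.secondDeriv f‖ :=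
    fun f hf => norm_pos_iff.2 fun h =>
      hf (SobolevD.secondDeriv_injective (by rw [h, map_zero]))
  have hune : u ≠ 0 := fun h => hu0 (by simp [h])
  have hratio : ‖E₂ u‖ / ‖SobolevD.secondDeriv u‖ = ‖E₂‖ := by
    rw [hE, huE, hnorm, mul_div_cancel_right₀ _ hu0]
  refine ⟨E₂, rfl, hnorm.trans (firstOrderConst_eq hpp'), ⟨?_, ?_⟩, fun g => ⟨?_, ?_⟩⟩
  · rintro ρ ⟨f, hf, rfl⟩
    rw [div_le_iff₀ (hpos f hf)]
    exact E₂.le_opNorm f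
  -- The supremum is attained at the sine, so every upper bound dominates `‖E₂‖`.
  · intro b hb
    exact hb ⟨u, hune, hratio.symm⟩
  · rintro ⟨f, hf, hfE, hfg⟩
    rw [div_eq_iff (hpos f hf).ne', hnorm] at hfE
    obtain ⟨c, hc⟩ := (SobolevD.norm_embedding_le hpp' f).2 hfE
    refine ⟨c, ?_, hfg.symm.trans hc⟩
    rintro rfl
    apply hf
    apply SobolevD.toLp_injective
    rw [map_zero, Lp.eq_zero_iff_ae_eq_zero]
    filter_upwards [hc] with x hx
    simpa using hx
  · rintro ⟨c, hc, hg⟩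
    refine ⟨c • u, smul_ne_zero hc hune, ?_, ?_⟩
    · rw [map_smul, map_smul, norm_smul, norm_smul, mul_div_mul_left _ _ (norm_ne_zero_iff.2 hc),
        hratio]
    · rw [map_smul]
      filter_upwards [Lp.coeFn_smul c (SobolevD.toLp u), hu, hg] with x h1 h2 h3
      rw [h1, h3, Pi.smul_apply, h2, smul_eq_mul]
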